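/- Let $\|A\|_p=(\sum_i\sigma_i(A)^p)^{1/p}$ denote the Schatten-$p$ norm of a real square matrix $A$ with singular values $\sigma_i(A)$. A (randomized) non-adaptive algorithm with $r$ matrix-vector queries of $k$ bits per entry, on $n\times n$ matrices, draws query vectors $q_1,\dots,q_r\in\mathbb R^n$ at random without looking at the input $A$, where each entry of each $q_j$ is specified by $k$ bits (that is, a decoding map $\{0,1\}^k\to\mathbb R$ is fixed in advance and every entry is the value of a $k$-bit string); it then receives $Aq_1,\dots,Aq_r$ and outputs a real number $t$ that depends on these responses and on its own randomness. **Theorem.** For every $\delta_0\in(0,1)$ there is a constant $c>0$, depending only on $\delta_0$, such that the following holds for all real $p>0$, all $\varepsilon\in(0,1)$, all $\delta\in(0,\delta_0]$ and all integers $k\ge 0$. There is $n_0$ (which may depend on $\delta_0,p,\varepsilon,\delta,k$) such that for every $n\ge n_0$, every non-adaptive algorithm with $r$ queries of $k$ bits per entry whose output $t$ satisfies, for every $A\in\mathbb R^{n\times n}$, $$\Pr\big[\,|t-\operatorname{tr}(A)|\le\varepsilon\|A\|_p\,\big]\ge 1-\delta$$ must make $$r\;\ge\; c\cdot\frac{\log^{p/2}(1/\delta)}{\varepsilon^p\,\big(k+\log(1/\varepsilon)\big)}$$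 queries. -/

import Mathlib

open MeasureTheory
open scoped Matrix

/-- The Schatten-`p` norm `(∑ σᵢ ^ p) ^ (1 / p)` of a real square matrix, where `σᵢ` are its
singular values. -/
noncomputable def schattenNorm (p : ℝ) {n : ℕ} (A : Matrix (Fin n) (Fin n) ℝ) : ℝ :=
  (∑ i : Fin n, (Matrix.toEuclideanLin A).singularValues (i : ℕ) ^ p) ^ (1 / p)

/-- A randomized non-adaptive algorithm that makes `r` matrix-vector queries to an `n × n` matrix,
each entry of each query vector being specified by `k` bits. The point `ω : Ω` is the random seed.
The query vectors depend on the seed only. The output depends on the seed and on the `r` response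
vectors. The way in which `k` bits encode a real number (integers, fixed point, floating point,
or any other code) is chosen by the algorithm. -/
structure NonAdaptiveAlgorithm (Ω : Type*) [MeasurableSpace Ω] (n r k : ℕ) where
  /-- The real number that a string of `k` bits stands for. -/
  decode : (Fin k → Bool) → ℝ
  /-- The bits of the entries of the `r` query vectors. -/
  queryBits : Ω → Fin r → Fin n → (Fin k → Bool)
  /-- The output, given the seed and the responses to the queries. -/
  output : Ω → (Fin r → Fin n → ℝ) → ℝ
  measurable_queryBits : Measurable queryBits
  measurable_output : Measurable (fun z : Ω × (Fin r → Fin n → ℝ) => output z.1 z.2)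

namespace NonAdaptiveAlgorithm

variable {Ω : Type*} [MeasurableSpace Ω] {n r k : ℕ}

/-- The `j`-th query vector. -/
def query (alg : NonAdaptiveAlgorithm Ω n r k) (ω : Ω) (j : Fin r) : Fin n → ℝ :=
  fun i => alg.decode (alg.queryBits ω j i)

/-- The estimate `t` computed on the matrix `A`, from the products of `A` with the queries. -/
def estimate (alg : NonAdaptiveAlgorithm Ω n r k) (A : Matrix (Fin n) (Fin n) ℝ) (ω : Ω) : ℝ :=
  alg.output ω (fun j => A *ᵥ alg.query ω j)

/-- For every real `n × n` matrix `A`, the estimate `t` satisfies `|t - tr A| ≤ ε ‖A‖_p` with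
probability at least `1 - δ` over the random seed, whose law is `μ`. -/
def EstimatesTrace (alg : NonAdaptiveAlgorithm Ω n r k) (μ : Measure Ω) (p ε δ : ℝ) : Prop :=
  ∀ A : Matrix (Fin n) (Fin n) ℝ,
    1 - δ ≤ μ.real {ω | |alg.estimate A ω - A.trace| ≤ ε * schattenNorm p A}

end NonAdaptiveAlgorithm

/-! The core is an indistinguishability argument with a Gaussian input. Let `A` be a Gaussian matrix
supported on diagonal blocks, and fix the seed. Non-adaptivity makes the queries independent of `A`,
so there is a direction `V` of Frobenius norm `t` that annihilates every query and has large trace,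
namely a multiple of the projection orthogonal to the queries. The estimator gives the same output
on `A, A + V, …, A + (J - 1)V`, whereas the traces differ by more than twice the allowed error, so
at most one output is acceptable. Translation by a multiple of `V` changes Gaussian measure by a
controlled factor. With `t = σ√(log (1/δ))` the forced failure probability exceeds `δ`. Using many
shifts instead of two makes the prefactor close to `1`, so every `δ₀ < 1` is covered. This is
`EstimatesTrace.gaussian_shift_le`.

For `p ≤ 2` a single block of size `m` of order `(√(log (1/δ)) / ε) ^ p` gives `r > m / 2`
(`EstimatesTrace.lt_two_mul_of_le_two`). For `p > 2` one takes `N` blocks of fixed size: the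
invisible trace grows like `√N`, while the Schatten norm grows more slowly, so any fixed number of
queries fails once `n` is large (`exists_card_not_estimatesTrace`).

The argument for `p ≤ 2` needs `m` to dominate `t`. In the remaining range a bit count suffices
(`exists_card_log_le_bits`): if `k * r` is small, two random coordinates receive identical query
bits too often, and then multiples of the projection onto `e_i - e_j` cannot be told apart. Only
this range uses the factor `k` in the denominator. -/

/-! ### Upper bounds for Schatten norms. -/

section Schatten

variable {n : ℕ} {p : ℝ}

theorem sum_sq_singularValues_eq (A : Matrix (Fin n) (Fin n) ℝ) :
    ∑ i : Fin n, (Matrix.toEuclideanLin A).singularValues (i : ℕ) ^ 2 = ∑ i, ∑ j, A i j ^ 2 := by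
  set T := Matrix.toEuclideanLin A with hT
  have hn : Module.finrank ℝ (EuclideanSpace ℝ (Fin n)) = n := by simp
  have h1 := T.isSymmetric_adjoint_comp_self.trace_eq_sum_eigenvalues hn
  simp only [LinearMap.sq_singularValues_fin T hn]
  rw [LinearMap.trace_eq_sum_inner _ (EuclideanSpace.basisFun (Fin n) ℝ)] at h1
  simp only [LinearMap.comp_apply, LinearMap.adjoint_inner_right, real_inner_self_eq_norm_sq,
    EuclideanSpace.real_norm_sq_eq, RCLike.ofReal_real_eq_id, id] at h1
  rw [← h1, Finset.sum_comm]
  refine Finset.sum_congr rfl fun i _ => Finset.sum_congr rfl fun j _ => ?_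
  simp [hT, Matrix.toLpLin_apply]

/-- Evaluate the quadratic form of `T* T` at an eigenvector for the squared singular value. -/
theorem singularValues_le_of_forall_sum_sq_le (A : Matrix (Fin n) (Fin n) ℝ) {X : ℝ} (hX : 0 ≤ X)
    (h : ∀ y : Fin n → ℝ, ∑ i, (A *ᵥ y) i ^ 2 ≤ X ^ 2 * ∑ i, y i ^ 2) (i : Fin n) :
    (Matrix.toEuclideanLin A).singularValues (i : ℕ) ≤ X := by
  set T := Matrix.toEuclideanLin A with hT
  have hn : (i : ℕ) < Module.finrank ℝ (EuclideanSpace ℝ (Fin n)) := by simp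
  obtain ⟨y, hy⟩ := (T.hasEigenvalue_adjoint_comp_self_sq_singularValues hn).exists_hasEigenvector
  have h1 : inner ℝ y ((T.adjoint ∘ₗ T) y) = T.singularValues i ^ 2 * ‖y‖ ^ 2 := by
    rw [hy.apply_eq_smul, real_inner_smul_right, real_inner_self_eq_norm_sq]
    rfl
  rw [LinearMap.comp_apply, LinearMap.adjoint_inner_right, real_inner_self_eq_norm_sq] at h1
  have h2 : ‖T y‖ ^ 2 ≤ X ^ 2 * ‖y‖ ^ 2 := by
    simpa [EuclideanSpace.real_norm_sq_eq, hT, Matrix.toLpLin_apply] using h y.ofLp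
  have hpos : 0 < ‖y‖ ^ 2 := by
    have := norm_pos_iff.2 hy.2
    positivity
  rw [h1] at h2
  exact le_of_sq_le_sq (le_of_mul_le_mul_right h2 hpos) hX

theorem singularValues_eq_zero_of_rank_le (A : Matrix (Fin n) (Fin n) ℝ) {i : ℕ}
    (h : A.rank ≤ i) : (Matrix.toEuclideanLin A).singularValues i = 0 := by
  rw [LinearMap.singularValues_eq_zero_iff_le_finrank_range]
  refine le_trans (le_of_eq ?_) h
  rw [Matrix.toEuclideanLin_eq_toLin_orthonormal]
  exact (Matrix.rank_eq_finrank_range_toLin A _ _).symm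

theorem sum_singularValues_rpow_eq (hp : 0 < p) (A : Matrix (Fin n) (Fin n) ℝ) {s : ℕ}
    (h : A.rank ≤ s) :
    ∑ i : Fin n, (Matrix.toEuclideanLin A).singularValues (i : ℕ) ^ p =
      ∑ i ∈ Finset.univ.filter (fun i : Fin n => (i : ℕ) < s), (Matrix.toEuclideanLin A).singularValues (i : ℕ) ^ p := by
  rw [Finset.sum_filter_of_ne]
  intro i _ hi
  by_contra hlt
  apply hi
  rw [singularValues_eq_zero_of_rank_le A (h.trans (not_lt.1 hlt)), Real.zero_rpow hp.ne']

theorem card_filter_fin_lt_le (s : ℕ) : (Finset.univ.filter fun i : Fin n => (i : ℕ) < s).card ≤ s := by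
  have := Finset.card_le_card_of_injOn (s := Finset.univ.filter fun i : Fin n => (i : ℕ) < s)
    (t := Finset.range s) (fun i : Fin n => (i : ℕ)) (by intro i; simp)
    (Fin.val_injective.injOn)
  simpa using this

/-- At most `s` singular values are nonzero, and each is bounded by the operator norm. This serves
the case `p > 2` and the rank-one matrices. -/
theorem schattenNorm_le_of_rank_le (hp : 0 < p) (A : Matrix (Fin n) (Fin n) ℝ) {s : ℕ}
    (hr : A.rank ≤ s) {X : ℝ} (hX : 0 ≤ X)
    (h : ∀ y : Fin n → ℝ, ∑ i, (A *ᵥ y) i ^ 2 ≤ X ^ 2 * ∑ i, y i ^ 2) :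
    schattenNorm p A ≤ (s : ℝ) ^ (1 / p) * X := by
  have h1 : ∑ i : Fin n, (Matrix.toEuclideanLin A).singularValues (i : ℕ) ^ p ≤ s * X ^ p := by
    rw [sum_singularValues_rpow_eq hp A hr]
    calc _ ≤ ∑ i ∈ Finset.univ.filter (fun i : Fin n => (i : ℕ) < s), X ^ p := Finset.sum_le_sum fun i _ =>
          Real.rpow_le_rpow (LinearMap.singularValues_nonneg _ _)
            (singularValues_le_of_forall_sum_sq_le A hX h i) hp.le
      _ ≤ s * X ^ p := by
          rw [Finset.sum_const, nsmul_eq_mul]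
          gcongr
          exact card_filter_fin_lt_le s
  calc schattenNorm p A ≤ (s * X ^ p) ^ (1 / p) := Real.rpow_le_rpow
        (Finset.sum_nonneg fun i _ => Real.rpow_nonneg (LinearMap.singularValues_nonneg _ _) _) h1
        (by positivity)
    _ = (s : ℝ) ^ (1 / p) * X := by
        rw [Real.mul_rpow (by positivity) (by positivity), ← Real.rpow_mul hX,
          mul_one_div_cancel hp.ne', Real.rpow_one]

/-- The power mean inequality with exponent `2 / p ≥ 1`, applied to `f i ^ p`. -/
theorem sum_rpow_le_card_rpow_mul {ι : Type*} (s : Finset ι) {f : ι → ℝ} (hf : ∀ i, 0 ≤ f i)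
    (hp : 0 < p) (hp2 : p ≤ 2) :
    ∑ i ∈ s, f i ^ p ≤ (s.card : ℝ) ^ (1 - p / 2) * (∑ i ∈ s, f i ^ 2) ^ (p / 2) := by
  have hq : 1 ≤ 2 / p := by rw [le_div_iff₀ hp]; linarith
  have h := Real.rpow_sum_le_const_mul_sum_rpow_of_nonneg s (f := fun i => f i ^ p) hq
    (fun i _ => Real.rpow_nonneg (hf i) p)
  have h0 : 0 ≤ ∑ i ∈ s, f i ^ p := Finset.sum_nonneg fun i _ => Real.rpow_nonneg (hf i) p
  have h2 : ∀ i, (f i ^ p) ^ (2 / p) = f i ^ 2 := fun i => by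
    rw [← Real.rpow_mul (hf i), mul_div_cancel₀ _ hp.ne', Real.rpow_two]
  simp only [h2] at h
  have h3 := Real.rpow_le_rpow (by positivity) h (by positivity : 0 ≤ p / 2)
  rw [← Real.rpow_mul h0, div_mul_div_cancel₀ hp.ne', div_self two_ne_zero, Real.rpow_one,
    Real.mul_rpow (by positivity) (Finset.sum_nonneg fun i _ => sq_nonneg _),
    ← Real.rpow_mul (by positivity)] at h3
  convert h3 using 3
  field_simp

/-- Hölder compares `ℓ^p` with `ℓ^2` on the at most `s` nonzero singular values. The Frobenius norm
is convenient because for a Gaussian matrix it is the Euclidean norm of the entries. -/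
theorem schattenNorm_le_frobenius (hp : 0 < p) (hp2 : p ≤ 2) (A : Matrix (Fin n) (Fin n) ℝ) {s : ℕ}
    (hr : A.rank ≤ s) {X : ℝ} (hX : 0 ≤ X) (h : ∑ i, ∑ j, A i j ^ 2 ≤ X ^ 2) :
    schattenNorm p A ≤ (s : ℝ) ^ (1 / p - 1 / 2) * X := by
  have h1 : ∑ i : Fin n, (Matrix.toEuclideanLin A).singularValues (i : ℕ) ^ p ≤
      (s : ℝ) ^ (1 - p / 2) * X ^ p := by
    rw [sum_singularValues_rpow_eq hp A hr]
    refine (sum_rpow_le_card_rpow_mul _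
      (fun i : Fin n => LinearMap.singularValues_nonneg (Matrix.toEuclideanLin A) (i : ℕ)) hp hp2).trans ?_
    have h2 : X ^ p = (X ^ 2) ^ (p / 2) := by
      rw [← Real.rpow_two, ← Real.rpow_mul hX]; congr 1; ring
    rw [h2]
    gcongr
    · linarith
    · exact card_filter_fin_lt_le s
    · refine le_trans ?_ h
      rw [← sum_sq_singularValues_eq]
      exact Finset.sum_le_sum_of_subset_of_nonneg (Finset.subset_univ _) fun _ _ _ => sq_nonneg _
  calc schattenNorm p A ≤ ((s : ℝ) ^ (1 - p / 2) * X ^ p) ^ (1 / p) := Real.rpow_le_rpow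
        (Finset.sum_nonneg fun i _ => Real.rpow_nonneg (LinearMap.singularValues_nonneg _ _) _) h1
        (by positivity)
    _ = (s : ℝ) ^ (1 / p - 1 / 2) * X := by
        rw [Real.mul_rpow (by positivity) (by positivity), ← Real.rpow_mul hX,
          mul_one_div_cancel hp.ne', Real.rpow_one, ← Real.rpow_mul (by positivity)]
        congr 2
        field_simp

end Schatten

/-! ### Gaussian measure under translation. -/

section Gaussian

open ProbabilityTheory

variable {ι : Type*} [Fintype ι]

/-- The law of a family of independent standard Gaussian variables. -/
noncomputable def gaussianPi (ι : Type*) [Fintype ι] : Measure (ι → ℝ) :=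
  Measure.pi fun _ => gaussianReal 0 1

instance : IsProbabilityMeasure (gaussianPi ι) := by unfold gaussianPi; infer_instance

theorem measurePreserving_eval_gaussianPi (i : ι) :
    MeasurePreserving (Function.eval i) (gaussianPi ι) (gaussianReal 0 1) :=
  measurePreserving_eval (fun _ : ι => gaussianReal 0 1) i

theorem gaussianPi_eq_withDensity :
    gaussianPi ι = (volume : Measure (ι → ℝ)).withDensity
      fun x => ENNReal.ofReal (∏ i, gaussianPDFReal 0 1 (x i)) := by
  refine Measure.pi_eq fun s hs => ?_
  rw [withDensity_apply _ (MeasurableSet.univ_pi hs), ← ofReal_integral_eq_lintegral_ofReal,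
    volume_pi, Measure.restrict_pi_pi, integral_fintype_prod_eq_prod,
    ENNReal.ofReal_prod_of_nonneg]
  · exact Finset.prod_congr rfl fun i _ =>
      (gaussianReal_apply_eq_integral 0 one_ne_zero (s i)).symm
  · exact fun i _ => integral_nonneg fun x => gaussianPDFReal_nonneg _ _ _
  · exact (Integrable.fintype_prod fun i => integrable_gaussianPDFReal 0 1).integrableOn
  · exact Filter.Eventually.of_forall fun x =>
      Finset.prod_nonneg fun i _ => gaussianPDFReal_nonneg _ _ _

theorem prod_gaussianPDFReal_add (x w : ι → ℝ) :
    ∏ i, gaussianPDFReal 0 1 (x i + w i) =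
      (∏ i, gaussianPDFReal 0 1 (x i)) *
        Real.exp (-(∑ i, x i * w i) - (∑ i, w i ^ 2) / 2) := by
  have h : -(∑ i, x i * w i) - (∑ i, w i ^ 2) / 2 = ∑ i, (-(x i * w i) - w i ^ 2 / 2) := by
    rw [Finset.sum_sub_distrib, Finset.sum_neg_distrib, Finset.sum_div]
  rw [h, Real.exp_sum, ← Finset.prod_mul_distrib]
  refine Finset.prod_congr rfl fun i _ => ?_
  simp only [gaussianPDFReal_def, NNReal.coe_one]
  rw [mul_assoc _ (Real.exp _) (Real.exp _), ← Real.exp_add]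
  congr 2
  ring

/-- Translating a set by `w` changes its Gaussian measure in a controlled way. -/
theorem exp_mul_gaussianPi_le {F W : Set (ι → ℝ)} (hF : MeasurableSet F) (hW : MeasurableSet W)
    (w : ι → ℝ) {a : ℝ} (ha : ∀ x ∈ W, ∑ i, x i * w i + (∑ i, w i ^ 2) / 2 ≤ a) :
    Real.exp (-a) * (gaussianPi ι).real {x ∈ W | x + w ∈ F} ≤ (gaussianPi ι).real F := by
  have hWF : MeasurableSet {x ∈ W | x + w ∈ F} :=
    hW.inter (hF.preimage (measurable_id.add_const w))
  set ρ : (ι → ℝ) → ENNReal := fun x => ENNReal.ofReal (∏ i, gaussianPDFReal 0 1 (x i)) with hρ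
  have key : ENNReal.ofReal (Real.exp (-a)) * gaussianPi ι {x ∈ W | x + w ∈ F} ≤
      gaussianPi ι F := by
    rw [gaussianPi_eq_withDensity, withDensity_apply _ hWF, withDensity_apply _ hF,
      ← lintegral_const_mul' _ _ ENNReal.ofReal_ne_top, ← lintegral_indicator hWF,
      ← lintegral_indicator hF, ← lintegral_add_right_eq_self (F.indicator _) w]
    refine lintegral_mono fun x => ?_
    by_cases hx : x ∈ {x ∈ W | x + w ∈ F}
    · rw [Set.indicator_of_mem hx, Set.indicator_of_mem hx.2]
      simp only [Pi.add_apply, prod_gaussianPDFReal_add]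
      rw [mul_comm, ← ENNReal.ofReal_mul
        (Finset.prod_nonneg fun i _ => gaussianPDFReal_nonneg _ _ _)]
      refine ENNReal.ofReal_le_ofReal (mul_le_mul_of_nonneg_left (Real.exp_le_exp.2 ?_)
        (Finset.prod_nonneg fun i _ => gaussianPDFReal_nonneg _ _ _))
      linarith [ha x hx.1]
    · rw [Set.indicator_of_notMem hx]
      exact zero_le
  have h2 := ENNReal.toReal_mono (measure_ne_top _ _) key
  rwa [ENNReal.toReal_mul, ENNReal.toReal_ofReal (Real.exp_pos _).le] at h2

/-- Chebyshev: the linear form is centred with variance `∑ v i ^ 2`. -/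
theorem gaussianPi_abs_sum_mul_ge_le (v : ι → ℝ) {t K : ℝ} (ht : 0 < t) (hK : 0 < K)
    (hv : ∑ i, v i ^ 2 ≤ t ^ 2) :
    (gaussianPi ι).real {x | K * t ≤ |∑ i, x i * v i|} ≤ 1 / K ^ 2 := by
  have hm : ∀ i, MemLp (fun y : ℝ => y * v i) 2 (gaussianReal 0 1) := fun i =>
    (memLp_id_gaussianReal' 2 (by simp)).mul_const (v i)
  have hS : (fun x : ι → ℝ => ∑ i, x i * v i) = ∑ i, fun x : ι → ℝ => x i * v i := by
    ext x; simp
  have hvar : Var[fun x : ι → ℝ => ∑ i, x i * v i; gaussianPi ι] = ∑ i, v i ^ 2 := by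
    rw [hS, gaussianPi, variance_sum_pi (X := fun i y => y * v i) hm]
    refine Finset.sum_congr rfl fun i _ => ?_
    rw [variance_mul_const, variance_fun_id_gaussianReal]
    simp
  have hmem : MemLp (fun x : ι → ℝ => ∑ i, x i * v i) 2 (gaussianPi ι) :=
    memLp_finsetSum _ fun i _ => (hm i).comp_measurePreserving (measurePreserving_eval_gaussianPi i)
  have hmean : ∫ x, (∑ i, x i * v i) ∂gaussianPi ι = 0 := by
    rw [integral_finsetSum]
    · refine Finset.sum_eq_zero fun i _ => ?_
      rw [integral_mul_const, gaussianPi, integral_eval]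
      simp
    · exact fun i _ => ((hm i).comp_measurePreserving
        (measurePreserving_eval_gaussianPi i)).integrable (by norm_num)
  have h := meas_ge_le_variance_div_sq hmem (mul_pos hK ht)
  rw [hmean, hvar] at h
  simp only [sub_zero] at h
  have h2 := ENNReal.toReal_mono ENNReal.ofReal_ne_top h
  rw [ENNReal.toReal_ofReal (div_nonneg (Finset.sum_nonneg fun i _ => sq_nonneg _)
    (by positivity))] at h2
  refine le_trans h2 ?_
  rw [div_le_div_iff₀ (by positivity) (by positivity)]
  nlinarith [mul_le_mul_of_nonneg_right hv (sq_nonneg K)]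

/-- A set that contains all but at most one of `x, x + v, …, x + (J - 1) v` for most `x` has
Gaussian measure bounded below in terms of `|v|`. -/
theorem le_gaussianPi_of_shifts {F Z : Set (ι → ℝ)} (hF : MeasurableSet F) (hZ : MeasurableSet Z)
    {v : ι → ℝ} {t K η : ℝ} (ht : 0 < t) (hK : 0 < K) (hv : ∑ i, v i ^ 2 ≤ t ^ 2) {J : ℕ}
    (hJ : 1 ≤ J) (hη : 1 - η ≤ (gaussianPi ι).real Z)
    (hFZ : ∀ x ∈ Z, ∀ i < J, ∀ j < J, i ≠ j → x + (i : ℝ) • v ∈ F ∨ x + (j : ℝ) • v ∈ F) :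
    (1 - 1 / (J : ℝ)) * (1 - η - 1 / K ^ 2) * Real.exp (-(J * K * t + J ^ 2 * t ^ 2 / 2)) ≤
      (gaussianPi ι).real F := by
  set γ := gaussianPi ι
  set C : Set (ι → ℝ) := {x | K * t ≤ |∑ i, x i * v i|}
  have hC : MeasurableSet C := measurableSet_le measurable_const (by fun_prop)
  -- Off `C` the linear form is below `K * t`, which bounds the density ratio for all `J` shifts at
  -- once.
  set W := Z \ C
  have hW : MeasurableSet W := hZ.diff hC
  have hWm : 1 - η - 1 / K ^ 2 ≤ γ.real W := by
    have h1 := gaussianPi_abs_sum_mul_ge_le v ht hK hv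
    have h2 := le_measureReal_sdiff (μ := γ) (s₁ := Z) (s₂ := C)
    change γ.real C ≤ _ at h1
    linarith
  set a := J * K * t + J ^ 2 * t ^ 2 / 2
  have hJ0 : (0 : ℝ) < J := by exact_mod_cast hJ
  set G : ℕ → Set (ι → ℝ) := fun j => {x ∈ W | x + (j : ℝ) • v ∈ F}
  have hG : ∀ j, MeasurableSet (G j) := fun j =>
    hW.inter (hF.preimage (measurable_id.add_const _))
  have h1 : ∀ j ∈ Finset.range J, Real.exp (-a) * γ.real (G j) ≤ γ.real F := by
    intro j hj
    refine exp_mul_gaussianPi_le hF hW _ fun x hx => ?_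
    have hxC : |∑ i, x i * v i| < K * t := not_le.1 hx.2
    have hj' : (j : ℝ) ≤ J := by exact_mod_cast (Finset.mem_range.1 hj).le
    have e1 : ∑ i, x i * ((j : ℝ) • v) i = j * ∑ i, x i * v i := by
      rw [Finset.mul_sum]; exact Finset.sum_congr rfl fun i _ => by simp; ring
    have e2 : ∑ i, ((j : ℝ) • v) i ^ 2 = j ^ 2 * ∑ i, v i ^ 2 := by
      rw [Finset.mul_sum]; exact Finset.sum_congr rfl fun i _ => by simp; ring
    rw [e1, e2]
    have b1 : j * ∑ i, x i * v i ≤ J * (K * t) :=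
      (mul_le_mul_of_nonneg_left ((le_abs_self _).trans hxC.le) (Nat.cast_nonneg j)).trans
        (mul_le_mul_of_nonneg_right hj' (by positivity))
    have b2 : (j : ℝ) ^ 2 * ∑ i, v i ^ 2 ≤ J ^ 2 * t ^ 2 := by
      gcongr
    simp only [a]
    linarith
  -- A point of `W` misses `F` under at most one shift, so the sets `W \ G j` are disjoint. Hence
  -- the `G j` have total measure at least `(J - 1) γ(W)`.
  have h2 : ∑ j ∈ Finset.range J, γ.real (W \ G j) ≤ γ.real W := by
    rw [← measureReal_biUnion_finset]
    · exact measureReal_mono (Set.iUnion₂_subset fun j _ => Set.sdiff_subset)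
    · intro i hi j hj hij
      refine Set.disjoint_left.2 fun x hxi hxj => ?_
      rcases hFZ x hxi.1.1 i (Finset.mem_range.1 hi) j (Finset.mem_range.1 hj) hij with h | h
      · exact hxi.2 ⟨hxi.1, h⟩
      · exact hxj.2 ⟨hxj.1, h⟩
    · exact fun j _ => hW.diff (hG j)
  have h3 : ∀ j, γ.real (W \ G j) = γ.real W - γ.real (G j) := fun j =>
    measureReal_sdiff (fun x hx => hx.1) (hG j)
  simp only [h3, Finset.sum_sub_distrib, Finset.sum_const, Finset.card_range, nsmul_eq_mul] at h2
  have h4 : Real.exp (-a) * ∑ j ∈ Finset.range J, γ.real (G j) ≤ J * γ.real F := by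
    rw [Finset.mul_sum]
    simpa using Finset.sum_le_sum h1
  have he := Real.exp_pos (-a)
  have hJ1 : (0 : ℝ) ≤ J - 1 := by
    have : (1 : ℝ) ≤ J := by exact_mod_cast hJ
    linarith
  have h5 : (J - 1) * (1 - η - 1 / K ^ 2) * Real.exp (-a) ≤ J * γ.real F := by
    calc _ ≤ (J - 1) * γ.real W * Real.exp (-a) := by gcongr
      _ ≤ (∑ j ∈ Finset.range J, γ.real (G j)) * Real.exp (-a) := by gcongr; linarith
      _ ≤ _ := by linarith
  have h6 : (1 - 1 / (J : ℝ)) * (1 - η - 1 / K ^ 2) * Real.exp (-a) =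
      ((J - 1) * (1 - η - 1 / K ^ 2) * Real.exp (-a)) / J := by
    field_simp
  rw [h6, div_le_iff₀ hJ0]
  linarith

end Gaussian

/-! ### Failure of an estimator on shifted Gaussian inputs. -/

namespace NonAdaptiveAlgorithm

variable {Ω : Type*} [MeasurableSpace Ω] {n r k : ℕ} (alg : NonAdaptiveAlgorithm Ω n r k)

theorem measurable_query (j : Fin r) (i : Fin n) : Measurable fun ω => alg.query ω j i :=
  (measurable_of_countable alg.decode).comp
    ((measurable_pi_apply i).comp ((measurable_pi_apply j).comp alg.measurable_queryBits))

theorem measurable_estimate {α : Type*} [MeasurableSpace α] {𝒜 : α → Matrix (Fin n) (Fin n) ℝ}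
    (h𝒜 : ∀ i j, Measurable fun x => 𝒜 x i j) :
    Measurable fun q : α × Ω => alg.estimate (𝒜 q.1) q.2 := by
  have h : ∀ j i, Measurable fun q : α × Ω => ∑ l, 𝒜 q.1 i l * alg.query q.2 j l := fun j i =>
    Finset.measurable_sum _ fun l _ =>
      ((h𝒜 i l).comp measurable_fst).mul ((alg.measurable_query j l).comp measurable_snd)
  exact alg.measurable_output.comp (measurable_snd.prodMk (measurable_pi_iff.2 fun j =>
    measurable_pi_iff.2 fun i => h j i))

theorem measurable_estimate_right (A : Matrix (Fin n) (Fin n) ℝ) : Measurable (alg.estimate A) :=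
  (alg.measurable_estimate (α := Unit) (𝒜 := fun _ => A) fun _ _ => measurable_const).comp
    (measurable_const.prodMk measurable_id : Measurable fun ω : Ω => ((), ω))

theorem estimate_eq_of_mulVec_eq {A B : Matrix (Fin n) (Fin n) ℝ} {ω : Ω}
    (h : ∀ j, A *ᵥ alg.query ω j = B *ᵥ alg.query ω j) : alg.estimate A ω = alg.estimate B ω := by
  unfold estimate
  congr 1
  exact funext h

variable {alg} {μ : Measure Ω} [IsProbabilityMeasure μ] {p ε δ : ℝ}

theorem EstimatesTrace.measure_error_le (hest : alg.EstimatesTrace μ p ε δ)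
    (A : Matrix (Fin n) (Fin n) ℝ) {h : ℝ} (hA : ε * schattenNorm p A ≤ h) :
    μ.real {ω | h < |alg.estimate A ω - A.trace|} ≤ δ := by
  have hmeas : Measurable fun ω => |alg.estimate A ω - A.trace| :=
    ((alg.measurable_estimate_right A).sub_const _).abs
  have hm : MeasurableSet {ω | |alg.estimate A ω - A.trace| ≤ h} :=
    measurableSet_le hmeas measurable_const
  have h1 : 1 - δ ≤ μ.real {ω | |alg.estimate A ω - A.trace| ≤ h} :=
    (hest A).trans (measureReal_mono fun ω hω => le_trans hω hA)
  have h2 := probReal_compl_eq_one_sub (μ := μ) hm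
  have h3 : {ω | |alg.estimate A ω - A.trace| ≤ h}ᶜ = {ω | h < |alg.estimate A ω - A.trace|} := by
    ext ω; simp
  rw [h3] at h2
  linarith

/-- If a Gaussian matrix can be shifted in a direction that is invisible to the queries and changes
the trace by more than twice the allowed error, then the estimator fails with a probability that is
bounded below. -/
theorem EstimatesTrace.gaussian_shift_le (hest : alg.EstimatesTrace μ p ε δ)
    {ι : Type*} [Fintype ι] (𝒜 : (ι → ℝ) →ₗ[ℝ] Matrix (Fin n) (Fin n) ℝ)
    {Y Z : Set (ι → ℝ)} (hY : MeasurableSet Y) (hZ : MeasurableSet Z) {h t K η : ℝ} {J : ℕ}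
    (ht : 0 < t) (hK : 0 < K) (hJ : 1 ≤ J) (hη : 1 - η ≤ (gaussianPi ι).real Z)
    (hYh : ∀ x ∈ Y, ε * schattenNorm p (𝒜 x) ≤ h)
    (hQ : ∀ Q : Fin r → Fin n → ℝ,
      ∃ v, ∑ i, v i ^ 2 ≤ t ^ 2 ∧ (∀ j, 𝒜 v *ᵥ Q j = 0) ∧ 2 * h < (𝒜 v).trace)
    (hZY : ∀ x ∈ Z, ∀ v : ι → ℝ, ∑ i, v i ^ 2 ≤ t ^ 2 → ∀ j < J, x + (j : ℝ) • v ∈ Y) :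
    (1 - 1 / (J : ℝ)) * (1 - η - 1 / K ^ 2) * Real.exp (-(J * K * t + J ^ 2 * t ^ 2 / 2)) ≤ δ := by
  set β := (1 - 1 / (J : ℝ)) * (1 - η - 1 / K ^ 2) * Real.exp (-(J * K * t + J ^ 2 * t ^ 2 / 2))
  set γ := gaussianPi ι
  have h𝒜 : ∀ i j, Measurable fun x => 𝒜 x i j := fun i j => by
    have := LinearMap.continuous_of_finiteDimensional ((Matrix.entryLinearMap ℝ ℝ i j).comp 𝒜)
    exact this.measurable
  have htr : Measurable fun x => (𝒜 x).trace :=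
    Finset.measurable_sum _ fun i _ => h𝒜 i i
  set S : Set ((ι → ℝ) × Ω) :=
    {q | q.1 ∈ Y ∧ h < |alg.estimate (𝒜 q.1) q.2 - (𝒜 q.1).trace|} with hS
  have hSm : MeasurableSet S := (hY.preimage measurable_fst).inter
    (measurableSet_lt measurable_const
      ((alg.measurable_estimate h𝒜).sub (htr.comp measurable_fst)).abs)
  have h0 : 0 ≤ δ := measureReal_nonneg.trans (hest.measure_error_le 0 le_rfl)
  -- Fubini in two orders: for fixed input the guarantee bounds the failure over seeds by `δ`, and
  -- for fixed seed the shifts bound the failure over inputs below by `β`.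
  have hup : (γ.prod μ) S ≤ ENNReal.ofReal δ := by
    rw [Measure.prod_apply hSm]
    calc ∫⁻ x, μ (Prod.mk x ⁻¹' S) ∂γ ≤ ∫⁻ _, ENNReal.ofReal δ ∂γ := by
          refine lintegral_mono fun x => ?_
          by_cases hx : x ∈ Y
          · have h1 := hest.measure_error_le (𝒜 x) (hYh x hx)
            rw [measureReal_def] at h1
            refine le_trans (measure_mono fun ω hω => hω.2)
              ((ENNReal.le_ofReal_iff_toReal_le (measure_ne_top _ _) h0).2 h1)
          · have : Prod.mk x ⁻¹' S = ∅ := by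
              ext ω; simp [hS, hx]
            simp [this]
      _ = ENNReal.ofReal δ := by simp
  have hlow : ENNReal.ofReal β ≤ (γ.prod μ) S := by
    rw [Measure.prod_apply_symm hSm]
    calc ENNReal.ofReal β = ∫⁻ _, ENNReal.ofReal β ∂μ := by simp
      _ ≤ ∫⁻ ω, γ ((fun x => (x, ω)) ⁻¹' S) ∂μ := by
          refine lintegral_mono fun ω => ?_
          rw [ENNReal.ofReal_le_iff_le_toReal (measure_ne_top _ _), ← measureReal_def]
          -- The direction may depend on the seed but not on `x`; this is where non-adaptivity
          -- enters.
          obtain ⟨v, hv, hv0, hvt⟩ := hQ (alg.query ω)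
          refine le_gaussianPi_of_shifts (hSm.preimage (by fun_prop)) hZ ht hK hv hJ hη ?_
          intro x hx i hi j hj hij
          by_contra! hcon
          have hmem : ∀ l < J, x + (l : ℝ) • v ∉ (fun x => (x, ω)) ⁻¹' S →
              |alg.estimate (𝒜 x) ω - (𝒜 x).trace - l * (𝒜 v).trace| ≤ h := by
            intro l hl hlS
            have h1 : ¬ h < |alg.estimate (𝒜 (x + (l : ℝ) • v)) ω
                - (𝒜 (x + (l : ℝ) • v)).trace| := fun hlt => hlS ⟨hZY x hx v hv l hl, hlt⟩
            have h2 : alg.estimate (𝒜 (x + (l : ℝ) • v)) ω = alg.estimate (𝒜 x) ω :=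
              alg.estimate_eq_of_mulVec_eq fun j => by
                rw [map_add, map_smul, Matrix.add_mulVec, Matrix.smul_mulVec, hv0, smul_zero,
                  add_zero]
            rw [h2, map_add, map_smul, Matrix.trace_add, Matrix.trace_smul, smul_eq_mul,
              ← sub_sub] at h1
            exact not_lt.1 h1
          -- Two acceptable shifts would put `(j - i) * (𝒜 v).trace` within `2 * h` of zero,
          -- although a single step already exceeds `2 * h`.
          have hi' := abs_le.1 (hmem i hi hcon.1)
          have hj' := abs_le.1 (hmem j hj hcon.2)
          rcases lt_or_gt_of_ne hij with hlt | hlt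
          · have : (i : ℝ) + 1 ≤ j := by exact_mod_cast hlt
            nlinarith
          · have : (j : ℝ) + 1 ≤ i := by exact_mod_cast hlt
            nlinarith
      _ = _ := rfl
  exact (ENNReal.ofReal_le_ofReal_iff h0).1 (hlow.trans hup)

end NonAdaptiveAlgorithm

/-! ### Block-diagonal matrices and directions invisible to the queries. -/

section BlockMatrix

theorem trace_transpose_mul_self_eq {m : Type*} [Fintype m] (A : Matrix m m ℝ) :
    (Aᵀ * A).trace = ∑ i, ∑ j, A i j ^ 2 := by
  rw [Finset.sum_comm]
  simp [Matrix.trace, Matrix.mul_apply, sq]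

/-- The orthogonal projection to the complement of `r` vectors. -/
theorem exists_projection_mulVec_eq_zero {b r : ℕ} (q : Fin r → Fin b → ℝ) :
    ∃ P : Matrix (Fin b) (Fin b) ℝ, (∀ j, P *ᵥ q j = 0) ∧
      ∑ i, ∑ j, P i j ^ 2 = P.trace ∧ (b : ℝ) - r ≤ P.trace := by
  set V : Submodule ℝ (EuclideanSpace ℝ (Fin b)) :=
    Submodule.span ℝ (Set.range fun j => WithLp.toLp 2 (q j))
  have hV : Module.finrank ℝ V ≤ r :=
    (finrank_range_le_card (R := ℝ) fun j => WithLp.toLp 2 (q j)).trans_eq (Fintype.card_fin r)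
  have hd : (b : ℝ) - r ≤ Module.finrank ℝ Vᗮ := by
    have h1 : Module.finrank ℝ V + Module.finrank ℝ Vᗮ = b := by
      rw [Submodule.finrank_add_finrank_orthogonal]; simp
    have h2 : (b : ℝ) = Module.finrank ℝ V + Module.finrank ℝ Vᗮ := by exact_mod_cast h1.symm
    have h3 : (Module.finrank ℝ V : ℝ) ≤ r := by exact_mod_cast hV
    linarith
  let w := stdOrthonormalBasis ℝ Vᗮ
  let W : Matrix (Fin b) (Fin (Module.finrank ℝ Vᗮ)) ℝ :=
    Matrix.of fun i l => (w l : EuclideanSpace ℝ (Fin b)) i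
  have hW : Wᵀ * W = 1 := by
    ext l l'
    have h := orthonormal_iff_ite.1 w.orthonormal l' l
    rw [Submodule.coe_inner, PiLp.inner_apply] at h
    simp only [RCLike.inner_apply, conj_trivial] at h
    simp only [Matrix.mul_apply, Matrix.transpose_apply, W, Matrix.of_apply, Matrix.one_apply]
    rw [h]
    by_cases hl : l = l'
    · rw [if_pos hl, if_pos hl.symm]
    · rw [if_neg hl, if_neg (Ne.symm hl)]
  have htr : (W * Wᵀ).trace = Module.finrank ℝ Vᗮ := by
    rw [Matrix.trace_mul_comm, hW]; simp
  refine ⟨W * Wᵀ, fun j => ?_, ?_, by rw [htr]; exact hd⟩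
  · have h0 : Wᵀ *ᵥ q j = 0 := by
      ext l
      have h := (Submodule.mem_orthogonal V _).1 (w l).2 (WithLp.toLp 2 (q j))
        (Submodule.subset_span ⟨j, rfl⟩)
      rw [PiLp.inner_apply] at h
      simp only [RCLike.inner_apply, conj_trivial] at h
      exact h
    rw [← Matrix.mulVec_mulVec, h0, Matrix.mulVec_zero]
  · rw [← trace_transpose_mul_self_eq, Matrix.transpose_mul, Matrix.transpose_transpose,
      Matrix.mul_assoc, ← Matrix.mul_assoc Wᵀ, hW, Matrix.one_mul]

variable {n N b : ℕ}

/-- The `n × (b · N)` matrix of the coordinate embedding `e`. -/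
def embeddingMatrix (e : Fin b × Fin N ↪ Fin n) : Matrix (Fin n) (Fin b × Fin N) ℝ :=
  Matrix.of fun i q => if i = e q then 1 else 0

theorem embeddingMatrix_transpose_mulVec (e : Fin b × Fin N ↪ Fin n) (y : Fin n → ℝ)
    (q : Fin b × Fin N) : ((embeddingMatrix e)ᵀ *ᵥ y) q = y (e q) := by
  simp [embeddingMatrix, Matrix.mulVec, dotProduct]

theorem embeddingMatrix_transpose_mul_self (e : Fin b × Fin N ↪ Fin n) :
    (embeddingMatrix e)ᵀ * embeddingMatrix e = 1 := by
  ext q q'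
  simp [embeddingMatrix, Matrix.mul_apply, Matrix.one_apply, eq_comm]

/-- The matrix with `N` diagonal blocks of size `b × b` on the coordinates given by `e`. -/
def blockEmbedding (e : Fin b × Fin N ↪ Fin n) :
    (Fin N × Fin b × Fin b → ℝ) →ₗ[ℝ] Matrix (Fin n) (Fin n) ℝ where
  toFun x := embeddingMatrix e * Matrix.blockDiagonal (fun B => Matrix.of fun a c => x (B, a, c)) *
    (embeddingMatrix e)ᵀ
  map_add' x y := by
    rw [← Matrix.add_mul, ← Matrix.mul_add, ← Matrix.blockDiagonal_add]; rfl
  map_smul' s x := by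
    rw [RingHom.id_apply, ← Matrix.smul_mul, ← Matrix.mul_smul, ← Matrix.blockDiagonal_smul]; rfl

variable (e : Fin b × Fin N ↪ Fin n) (x : Fin N × Fin b × Fin b → ℝ)

theorem blockEmbedding_apply : blockEmbedding e x = embeddingMatrix e *
    Matrix.blockDiagonal (fun B => Matrix.of fun a c => x (B, a, c)) * (embeddingMatrix e)ᵀ := rfl

theorem trace_blockEmbedding : (blockEmbedding e x).trace = ∑ B, ∑ a, x (B, a, a) := by
  rw [blockEmbedding_apply, Matrix.trace_mul_comm, ← Matrix.mul_assoc,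
    embeddingMatrix_transpose_mul_self, Matrix.one_mul, Matrix.trace_blockDiagonal]
  rfl

theorem sum_sq_blockEmbedding :
    ∑ i, ∑ j, blockEmbedding e x i j ^ 2 = ∑ q, x q ^ 2 := by
  rw [← trace_transpose_mul_self_eq, blockEmbedding_apply]
  set U := embeddingMatrix e
  set D := Matrix.blockDiagonal (fun B => Matrix.of fun a c => x (B, a, c))
  have h : (U * D * Uᵀ)ᵀ * (U * D * Uᵀ) = U * ((Dᵀ * D) * Uᵀ) := by
    simp only [Matrix.transpose_mul, Matrix.transpose_transpose, Matrix.mul_assoc]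
    rw [← Matrix.mul_assoc Uᵀ U, embeddingMatrix_transpose_mul_self, Matrix.one_mul]
  rw [h, Matrix.trace_mul_comm, Matrix.mul_assoc, embeddingMatrix_transpose_mul_self,
    Matrix.mul_one, Matrix.blockDiagonal_transpose, ← Matrix.blockDiagonal_mul,
    Matrix.trace_blockDiagonal, Fintype.sum_prod_type]
  refine Finset.sum_congr rfl fun B _ => ?_
  rw [trace_transpose_mul_self_eq, Fintype.sum_prod_type]
  rfl

theorem rank_blockEmbedding_le : (blockEmbedding e x).rank ≤ b * N := by
  rw [blockEmbedding_apply, Matrix.mul_assoc]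
  refine (Matrix.rank_mul_le_left _ _).trans ((Matrix.rank_le_card_width _).trans ?_)
  simp

theorem blockEmbedding_mulVec_eq_zero {y : Fin n → ℝ}
    (h : ∀ B, (Matrix.of fun a c => x (B, a, c)) *ᵥ (fun c => y (e (c, B))) = 0) :
    blockEmbedding e x *ᵥ y = 0 := by
  have h0 : Matrix.blockDiagonal (fun B => Matrix.of fun a c => x (B, a, c)) *ᵥ
      ((embeddingMatrix e)ᵀ *ᵥ y) = 0 := by
    ext ⟨a, B⟩
    have := congrFun (h B) a
    simp only [Matrix.mulVec, dotProduct, Matrix.of_apply, Pi.zero_apply] at this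
    simp only [Matrix.mulVec, dotProduct, Matrix.blockDiagonal_apply, Pi.zero_apply]
    rw [Fintype.sum_prod_type]
    refine Eq.trans ?_ this
    refine Finset.sum_congr rfl fun c _ => ?_
    rw [Finset.sum_eq_single B]
    · have := embeddingMatrix_transpose_mulVec e y (c, B)
      simp only [Matrix.mulVec, dotProduct] at this
      rw [this]; simp
    · intro B' _ hB'
      simp [hB'.symm]
    · simp
  rw [blockEmbedding_apply, ← Matrix.mulVec_mulVec, ← Matrix.mulVec_mulVec, h0, Matrix.mulVec_zero]

/-- Each `b × b` block has Frobenius norm at most `b * X`. The operator norm of a block-diagonal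
matrix is the maximum over its blocks, so `N` does not enter. -/
theorem sum_sq_blockEmbedding_mulVec_le {X : ℝ} (hx : ∀ q, |x q| ≤ X) (y : Fin n → ℝ) :
    ∑ i, (blockEmbedding e x *ᵥ y) i ^ 2 ≤ (b * X) ^ 2 * ∑ i, y i ^ 2 := by
  set U := embeddingMatrix e
  set D := Matrix.blockDiagonal (fun B => Matrix.of fun a c => x (B, a, c)) with hD
  set w := Uᵀ *ᵥ y with hw
  have h1 : ∑ i, (blockEmbedding e x *ᵥ y) i ^ 2 = ∑ q, (D *ᵥ w) q ^ 2 := by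
    have : ∀ {m : Type} [Fintype m] (z : m → ℝ), ∑ i, z i ^ 2 = z ⬝ᵥ z := fun z => by
      simp [dotProduct, sq]
    rw [this, this, blockEmbedding_apply, ← Matrix.mulVec_mulVec, ← Matrix.mulVec_mulVec,
      Matrix.dotProduct_mulVec, Matrix.vecMul_mulVec, ← Matrix.mulVec_transpose]
    simp [U, embeddingMatrix_transpose_mul_self, hw, D]
  have h2 : ∑ q, w q ^ 2 ≤ ∑ i, y i ^ 2 := by
    simp only [hw, U, embeddingMatrix_transpose_mulVec]
    have := Finset.sum_map Finset.univ e fun i => y i ^ 2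
    rw [← this]
    exact Finset.sum_le_sum_of_subset_of_nonneg (Finset.subset_univ _) fun _ _ _ => sq_nonneg _
  have h3 : ∀ a B, (D *ᵥ w) (a, B) = ∑ c, x (B, a, c) * w (c, B) := by
    intro a B
    simp only [Matrix.mulVec, dotProduct, hD, Matrix.blockDiagonal_apply]
    rw [Fintype.sum_prod_type]
    refine Finset.sum_congr rfl fun c _ => ?_
    rw [Finset.sum_eq_single B]
    · simp
    · intro B' _ hB'
      simp [hB'.symm]
    · simp
  have h4 : ∀ a B, (D *ᵥ w) (a, B) ^ 2 ≤ b * X ^ 2 * ∑ c, w (c, B) ^ 2 := by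
    intro a B
    rw [h3]
    refine (Finset.sum_mul_sq_le_sq_mul_sq _ _ _).trans ?_
    gcongr
    calc ∑ c, x (B, a, c) ^ 2 ≤ ∑ _c : Fin b, X ^ 2 :=
          Finset.sum_le_sum fun c _ => sq_le_sq' (abs_le.1 (hx _)).1 (abs_le.1 (hx _)).2
      _ = b * X ^ 2 := by simp
  calc _ = ∑ q, (D *ᵥ w) q ^ 2 := h1
    _ = ∑ a, ∑ B, (D *ᵥ w) (a, B) ^ 2 := Fintype.sum_prod_type _
    _ ≤ ∑ _a : Fin b, ∑ B, b * X ^ 2 * ∑ c, w (c, B) ^ 2 :=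
        Finset.sum_le_sum fun a _ => Finset.sum_le_sum fun B _ => h4 a B
    _ = (b * X) ^ 2 * ∑ q, w q ^ 2 := by
        rw [Fintype.sum_prod_type_right, ← Finset.mul_sum]
        simp
        ring
    _ ≤ _ := by gcongr

/-- A direction of length `t` that is invisible to the queries and has a large trace. -/
theorem exists_invisible_direction {r : ℕ} {t : ℝ} (ht : 0 < t) (hr : r < b) (hN : 0 < N)
    (Q : Fin r → Fin n → ℝ) :
    ∃ v, ∑ i, v i ^ 2 ≤ t ^ 2 ∧ (∀ j, blockEmbedding e v *ᵥ Q j = 0) ∧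
      t * √(N * ((b : ℝ) - r)) ≤ (blockEmbedding e v).trace := by
  choose P hP0 hP2 hPt using fun B : Fin N =>
    exists_projection_mulVec_eq_zero fun j c => Q j (e (c, B))
  set d := ∑ B, (P B).trace
  have hdN : N * ((b : ℝ) - r) ≤ d := by
    have := Finset.sum_le_sum fun B (_ : B ∈ Finset.univ) => hPt B
    rwa [Finset.sum_const, Finset.card_univ, Fintype.card_fin, nsmul_eq_mul] at this
  have hbr : (0 : ℝ) < N * ((b : ℝ) - r) := by
    have : (r : ℝ) < b := by exact_mod_cast hr
    have : (0 : ℝ) < N := by exact_mod_cast hN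
    nlinarith
  have hd : 0 < d := hbr.trans_le hdN
  have hs : √d ^ 2 = d := Real.sq_sqrt hd.le
  have hs0 : 0 < √d := Real.sqrt_pos.2 hd
  -- The normalised block projection. Its squared Frobenius norm equals its trace `d`, so scaling to
  -- length `t` leaves trace `t * √d`.
  refine ⟨fun q => t / √d * P q.1 q.2.1 q.2.2, ?_, fun j => ?_, ?_⟩
  · simp only [mul_pow, ← Finset.mul_sum, Fintype.sum_prod_type, hP2, div_pow, hs]
    rw [div_mul_cancel₀ _ hd.ne']
  · refine blockEmbedding_mulVec_eq_zero e _ fun B => ?_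
    have : (Matrix.of fun a c => t / √d * P B a c) = (t / √d) • P B := rfl
    simp only [this, Matrix.smul_mulVec, hP0, smul_zero]
  · rw [trace_blockEmbedding]
    have : ∑ B, ∑ a, t / √d * P B a a = t * √d := by
      simp only [← Finset.mul_sum]
      change t / √d * d = _
      rw [div_mul_eq_mul_div, div_eq_iff hs0.ne', mul_assoc, ← sq, hs]
    simp only [this]
    gcongr

end BlockMatrix

/-! ### Pairs of coordinates that the query bits do not separate. -/

section PairMatrix

variable {n : ℕ}

/-- The orthogonal projection to the line spanned by `e_i - e_j`. -/
noncomputable def pairMatrix (i j : Fin n) : Matrix (Fin n) (Fin n) ℝ :=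
  (1 / 2 : ℝ) • Matrix.vecMulVec (Pi.single i 1 - Pi.single j 1) (Pi.single i 1 - Pi.single j 1)

theorem pairMatrix_mulVec (i j : Fin n) (y : Fin n → ℝ) :
    pairMatrix i j *ᵥ y = ((y i - y j) / 2) • (Pi.single i 1 - Pi.single j 1) := by
  rw [pairMatrix, Matrix.smul_mulVec, Matrix.vecMulVec_mulVec, sub_dotProduct]
  simp only [single_dotProduct, one_mul, op_smul_eq_smul, smul_smul]
  congr 1
  ring

theorem dotProduct_single_sub_single {i j : Fin n} (h : i ≠ j) :
    (Pi.single i 1 - Pi.single j 1 : Fin n → ℝ) ⬝ᵥ (Pi.single i 1 - Pi.single j 1) = 2 := by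
  rw [sub_dotProduct]
  simp only [single_dotProduct, one_mul, Pi.sub_apply, Pi.single_eq_same, Pi.single_eq_of_ne h,
    Pi.single_eq_of_ne h.symm]
  norm_num

theorem trace_pairMatrix {i j : Fin n} (h : i ≠ j) : (pairMatrix i j).trace = 1 := by
  rw [pairMatrix, Matrix.trace_smul, Matrix.trace_vecMulVec, dotProduct_single_sub_single h]
  norm_num

theorem schattenNorm_smul_pairMatrix_le {p : ℝ} (hp : 0 < p) (i j : Fin n) {s : ℝ} (hs : 0 ≤ s) :
    schattenNorm p (s • pairMatrix i j) ≤ s := by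
  have hr : (s • pairMatrix i j).rank ≤ 1 := by
    rw [pairMatrix, smul_smul, ← Matrix.smul_vecMulVec]
    exact Matrix.rank_vecMulVec_le _ _
  refine (schattenNorm_le_of_rank_le hp _ hr hs fun y => ?_).trans (by simp)
  rw [Matrix.smul_mulVec]
  simp only [Pi.smul_apply, smul_eq_mul, mul_pow, ← Finset.mul_sum]
  refine mul_le_mul_of_nonneg_left ?_ (sq_nonneg s)
  have hy : 0 ≤ ∑ a, y a ^ 2 := Finset.sum_nonneg fun _ _ => sq_nonneg _
  rw [pairMatrix_mulVec]
  by_cases h : i = j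
  · simpa [h] using hy
  · have h1 := dotProduct_single_sub_single h
    simp only [dotProduct, ← sq] at h1
    simp only [Pi.smul_apply, smul_eq_mul, mul_pow, ← Finset.mul_sum, h1]
    have h2 : y i ^ 2 + y j ^ 2 ≤ ∑ a, y a ^ 2 := by
      rw [← Finset.sum_pair (f := fun a => y a ^ 2) h]
      exact Finset.sum_le_sum_of_subset_of_nonneg (Finset.subset_univ _) fun _ _ _ => sq_nonneg _
    nlinarith [sq_nonneg (y i + y j)]

end PairMatrix

/-- Cauchy–Schwarz on the fiber sizes. The pairs counted include the diagonal ones. -/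
theorem sq_card_le_card_mul_card_fiber_pairs {α β : Type*} [Fintype α] [Fintype β] [DecidableEq β]
    (f : α → β) : (Fintype.card α : ℝ) ^ 2 ≤
      Fintype.card β * ∑ i, ∑ j, if f i = f j then (1 : ℝ) else 0 := by
  have h1 : ∑ c, (∑ i, if f i = c then (1 : ℝ) else 0) = Fintype.card α := by
    rw [Finset.sum_comm]; simp
  have h2 : ∑ c, (∑ i, if f i = c then (1 : ℝ) else 0) ^ 2 =
      ∑ i, ∑ j, if f i = f j then (1 : ℝ) else 0 := by
    simp only [sq, Finset.sum_mul_sum]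
    rw [Finset.sum_comm]
    refine Finset.sum_congr rfl fun i _ => ?_
    rw [Finset.sum_comm]
    refine Finset.sum_congr rfl fun j _ => ?_
    simp [eq_comm]
  rw [← h1, ← h2]
  exact sq_sum_le_card_mul_sum_sq

namespace NonAdaptiveAlgorithm

variable {Ω : Type*} [MeasurableSpace Ω] {n r k : ℕ} {alg : NonAdaptiveAlgorithm Ω n r k}
  {μ : Measure Ω} [IsProbabilityMeasure μ] {p ε δ : ℝ}

/-- At most one of the matrices `ρ ^ l • pairMatrix i j` is handled correctly when no query
separates `i` from `j`. -/
theorem le_card_errors (hε0 : 0 < ε) (hε1 : ε < 1) {i j : Fin n} (hij : i ≠ j) {ω : Ω}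
    (h : ∀ a, alg.query ω a i = alg.query ω a j) (J : ℕ) {ρ : ℝ} (hρ1 : 1 ≤ ρ)
    (hρ : 1 + ε < (1 - ε) * ρ) :
    (J : ℝ) - 1 ≤ ∑ l ∈ Finset.range J,
      {ω | ε * ρ ^ l < |alg.estimate (ρ ^ l • pairMatrix i j) ω
        - (ρ ^ l • pairMatrix i j).trace|}.indicator (1 : Ω → ℝ) ω := by
  classical
  set T := alg.estimate 0 ω
  have hT : ∀ l : ℕ, alg.estimate (ρ ^ l • pairMatrix i j) ω = T := fun l =>
    alg.estimate_eq_of_mulVec_eq fun a => by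
      rw [Matrix.smul_mulVec, pairMatrix_mulVec, h a]; simp
  have htr : ∀ l : ℕ, (ρ ^ l • pairMatrix i j).trace = ρ ^ l := fun l => by
    rw [Matrix.trace_smul, trace_pairMatrix hij]; simp
  have hpos : ∀ l : ℕ, 0 < ρ ^ l := fun l => pow_pos (by linarith) l
  have hone : ((Finset.range J).filter fun l => ¬ ε * ρ ^ l < |T - ρ ^ l|).card ≤ 1 := by
    -- The acceptance intervals `[(1 - ε) ρ ^ l, (1 + ε) ρ ^ l]` are pairwise disjoint, so the
    -- common output `T` lies in at most one.
    have key : ∀ l l' : ℕ, l < l' → |T - ρ ^ l| ≤ ε * ρ ^ l → |T - ρ ^ l'| ≤ ε * ρ ^ l' →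
        False := by
      intro l l' hll h1 h2
      have h3 : ρ * ρ ^ l ≤ ρ ^ l' := by
        rw [← pow_succ']; exact pow_le_pow_right₀ hρ1 hll
      have h1' := (abs_le.1 h1).2
      have h2' := (abs_le.1 h2).1
      have h4 : (1 - ε) * (ρ * ρ ^ l) ≤ (1 - ε) * ρ ^ l' :=
        mul_le_mul_of_nonneg_left h3 (by linarith)
      nlinarith [mul_lt_mul_of_pos_right hρ (hpos l)]
    refine Finset.card_le_one.2 fun a ha b hb => ?_
    have ha' := not_lt.1 (Finset.mem_filter.1 ha).2
    have hb' := not_lt.1 (Finset.mem_filter.1 hb).2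
    by_contra hab
    rcases lt_or_gt_of_ne hab with hlt | hlt
    · exact key _ _ hlt ha' hb'
    · exact key _ _ hlt hb' ha'
  have hsum : ∑ l ∈ Finset.range J,
      {ω | ε * ρ ^ l < |alg.estimate (ρ ^ l • pairMatrix i j) ω
        - (ρ ^ l • pairMatrix i j).trace|}.indicator (1 : Ω → ℝ) ω =
      ((Finset.range J).filter fun l => ε * ρ ^ l < |T - ρ ^ l|).card := by
    rw [Finset.card_filter]
    push_cast
    refine Finset.sum_congr rfl fun l _ => ?_
    simp only [Set.indicator_apply, Set.mem_ofPred_eq, hT, htr, Pi.one_apply]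
  rw [hsum]
  have := Finset.card_filter_add_card_filter_not (s := Finset.range J)
    (fun l => ε * ρ ^ l < |T - ρ ^ l|)
  rw [Finset.card_range] at this
  have h5 : J ≤ ((Finset.range J).filter fun l => ε * ρ ^ l < |T - ρ ^ l|).card + 1 := by omega
  have h6 : (J : ℝ) ≤ ((Finset.range J).filter fun l => ε * ρ ^ l < |T - ρ ^ l|).card + 1 := by
    exact_mod_cast h5
  linarith

/-- Two random coordinates are not separated by the queries with probability about `2 ^ (-k r)`. -/
theorem EstimatesTrace.pair_le (hest : alg.EstimatesTrace μ p ε δ) (hp : 0 < p) (hε0 : 0 < ε)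
    (hε1 : ε < 1) (hn : 0 < n) {J : ℕ} (hJ : 1 ≤ J) :
    (1 - 1 / (J : ℝ)) * (1 / 2 ^ (k * r) - 1 / n) ≤ δ := by
  classical
  set ρ : ℝ := 2 * (1 + ε) / (1 - ε)
  have hε1' : 0 < 1 - ε := by linarith
  have hρ : 1 + ε < (1 - ε) * ρ := by
    rw [mul_div_cancel₀ _ hε1'.ne']; linarith
  have hρ1 : 1 ≤ ρ := by
    rw [le_div_iff₀ hε1']; linarith
  set Bad : Fin n → Fin n → ℕ → Set Ω := fun i j l =>
    {ω | ε * ρ ^ l < |alg.estimate (ρ ^ l • pairMatrix i j) ω - (ρ ^ l • pairMatrix i j).trace|}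
  have hBm : ∀ i j l, MeasurableSet (Bad i j l) := fun i j l =>
    measurableSet_lt measurable_const ((alg.measurable_estimate_right _).sub_const _).abs
  have hB : ∀ i j l, μ.real (Bad i j l) ≤ δ := fun i j l =>
    hest.measure_error_le _ (mul_le_mul_of_nonneg_left
      (schattenNorm_smul_pairMatrix_le hp i j (pow_nonneg (by linarith) l)) hε0.le)
  have hJ1 : (0 : ℝ) ≤ J - 1 := by
    have : (1 : ℝ) ≤ J := by exact_mod_cast hJ
    linarith
  set K : ℝ := 2 ^ (k * r) with hK
  have hK0 : 0 < K := by positivity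
  -- At least `n ^ 2 / K` ordered pairs collide; discarding the `n` diagonal ones, each remaining
  -- pair yields at least `J - 1` errors.
  have hpt : ∀ ω, (J - 1) * ((n : ℝ) ^ 2 / K - n) ≤
      ∑ i, ∑ j, ∑ l ∈ Finset.range J, (Bad i j l).indicator (1 : Ω → ℝ) ω := by
    intro ω
    set f : Fin n → (Fin r → Fin k → Bool) := fun i a => alg.queryBits ω a i
    have h1 := sq_card_le_card_mul_card_fiber_pairs f
    have hc : (Fintype.card (Fin r → Fin k → Bool) : ℝ) = K := by
      simp [hK, pow_mul]
    rw [hc, Fintype.card_fin, ← div_le_iff₀' hK0] at h1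
    have h2 : ∑ i : Fin n, ∑ j : Fin n, (J - 1) * ((if f i = f j then (1 : ℝ) else 0) -
        if i = j then 1 else 0) ≤
        ∑ i, ∑ j, ∑ l ∈ Finset.range J, (Bad i j l).indicator (1 : Ω → ℝ) ω := by
      refine Finset.sum_le_sum fun i _ => Finset.sum_le_sum fun j _ => ?_
      have h0 : 0 ≤ ∑ l ∈ Finset.range J, (Bad i j l).indicator (1 : Ω → ℝ) ω :=
        Finset.sum_nonneg fun l _ => Set.indicator_nonneg (fun _ _ => zero_le_one) _
      by_cases hij : i = j
      · simpa [hij] using h0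
      · by_cases hf : f i = f j
        · have : (J : ℝ) - 1 ≤ ∑ l ∈ Finset.range J, (Bad i j l).indicator (1 : Ω → ℝ) ω :=
            le_card_errors (alg := alg) hε0 hε1 hij (ω := ω) (fun a => by
              simp only [query]; exact congrArg alg.decode (congrFun hf a)) J hρ1 hρ
          rwa [if_pos hf, if_neg hij, sub_zero, mul_one]
        · simpa [hij, hf] using h0
    refine le_trans ?_ h2
    simp only [← Finset.mul_sum, Finset.sum_sub_distrib]
    refine mul_le_mul_of_nonneg_left ?_ hJ1
    simpa using h1
  have hint : ∀ i j l, Integrable ((Bad i j l).indicator (1 : Ω → ℝ)) μ := fun i j l =>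
    (integrable_const (1 : ℝ)).indicator (hBm i j l)
  have hlow : (J - 1) * ((n : ℝ) ^ 2 / K - n) ≤
      ∑ i, ∑ j, ∑ l ∈ Finset.range J, μ.real (Bad i j l) := by
    calc (J - 1) * ((n : ℝ) ^ 2 / K - n) = ∫ _, (J - 1) * ((n : ℝ) ^ 2 / K - n) ∂μ := by simp
      _ ≤ ∫ ω, ∑ i, ∑ j, ∑ l ∈ Finset.range J, (Bad i j l).indicator (1 : Ω → ℝ) ω ∂μ :=
          integral_mono (integrable_const _)
            (integrable_finsetSum _ fun i _ => integrable_finsetSum _ fun j _ =>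
              integrable_finsetSum _ fun l _ => hint i j l) hpt
      _ = _ := by
          rw [integral_finsetSum _ fun i _ => integrable_finsetSum _ fun j _ =>
              integrable_finsetSum _ fun l _ => hint i j l]
          refine Finset.sum_congr rfl fun i _ => ?_
          rw [integral_finsetSum _ fun j _ => integrable_finsetSum _ fun l _ => hint i j l]
          refine Finset.sum_congr rfl fun j _ => ?_
          rw [integral_finsetSum _ fun l _ => hint i j l]
          exact Finset.sum_congr rfl fun l _ => integral_indicator_one (hBm i j l)
  have hup : ∑ i, ∑ j, ∑ l ∈ Finset.range J, μ.real (Bad i j l) ≤ (n : ℝ) ^ 2 * J * δ := by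
    calc _ ≤ ∑ _i : Fin n, ∑ _j : Fin n, ∑ _l ∈ Finset.range J, δ :=
          Finset.sum_le_sum fun i _ => Finset.sum_le_sum fun j _ =>
            Finset.sum_le_sum fun l _ => hB i j l
      _ = _ := by simp; ring
  have hJ0 : (0 : ℝ) < J := by exact_mod_cast hJ
  have hn0 : (0 : ℝ) < n := by exact_mod_cast hn
  have hfin : (1 - 1 / (J : ℝ)) * (1 / K - 1 / n) =
      (J - 1) * ((n : ℝ) ^ 2 / K - n) / ((n : ℝ) ^ 2 * J) := by
    field_simp
  rw [hfin, div_le_iff₀ (by positivity)]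
  linarith [hlow.trans hup]

end NonAdaptiveAlgorithm

/-! ### Norm and coordinate tails of Gaussian vectors. -/

section GaussianTails

open ProbabilityTheory

variable {ι : Type*} [Fintype ι]

/-- Markov's inequality for the squared norm, whose mean is the dimension. -/
theorem one_sub_le_gaussianPi_sum_sq_le {a : ℝ} (ha : 0 < a) :
    1 - Fintype.card ι / a ^ 2 ≤ (gaussianPi ι).real {x | ∑ i, x i ^ 2 ≤ a ^ 2} := by
  have hmem : MemLp (id : ℝ → ℝ) 2 (gaussianReal 0 1) := memLp_id_gaussianReal' 2 (by simp)
  have hi : ∀ i, Integrable (fun x : ι → ℝ => x i ^ 2) (gaussianPi ι) := fun i =>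
    (measurePreserving_eval_gaussianPi i).integrable_comp_of_integrable (hmem.integrable_sq)
  have h1 : ∫ y, y ^ 2 ∂gaussianReal 0 1 = 1 := by
    have := variance_of_integral_eq_zero (μ := gaussianReal 0 1) (X := fun x => x)
      aemeasurable_id (by simp)
    rw [variance_fun_id_gaussianReal] at this
    simpa using this.symm
  have h2 : ∀ i, ∫ x, x i ^ 2 ∂gaussianPi ι = 1 := fun i => by
    rw [← h1]
    exact integral_comp_eval (μ := fun _ : ι => gaussianReal 0 1) (i := i)
      (f := fun y : ℝ => y ^ 2) (measurable_id.pow_const 2).aestronglyMeasurable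
  have h3 : ∫ x, ∑ i, x i ^ 2 ∂gaussianPi ι = Fintype.card ι := by
    rw [integral_finsetSum _ fun i _ => hi i]; simp [h2]
  have h4 := mul_meas_ge_le_integral_of_nonneg (μ := gaussianPi ι) (f := fun x => ∑ i, x i ^ 2)
    (Filter.Eventually.of_forall fun x => Finset.sum_nonneg fun i _ => sq_nonneg (x i))
    (integrable_finsetSum _ fun i _ => hi i) (a ^ 2)
  rw [h3, ← le_div_iff₀' (by positivity)] at h4
  have hm : MeasurableSet {x : ι → ℝ | ∑ i, x i ^ 2 ≤ a ^ 2} :=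
    measurableSet_le (by fun_prop) measurable_const
  have h5 := probReal_compl_eq_one_sub (μ := gaussianPi ι) hm
  have h6 : (gaussianPi ι).real {x : ι → ℝ | ∑ i, x i ^ 2 ≤ a ^ 2}ᶜ ≤
      (gaussianPi ι).real {x | a ^ 2 ≤ ∑ i, x i ^ 2} :=
    measureReal_mono fun x hx => by
      simp only [Set.mem_compl_iff, Set.mem_ofPred_eq, not_le] at hx ⊢
      exact hx.le
  linarith

/-- A polynomial tail bound for the largest coordinate of a Gaussian vector. -/
theorem exists_one_sub_le_gaussianPi_abs_le (s : ℝ) (hs : 0 < s) :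
    ∃ C : ℝ, 0 < C ∧ ∀ (ι : Type) [Fintype ι] (X : ℝ), 0 < X →
      1 - Fintype.card ι * C / X ^ s ≤ (gaussianPi ι).real {x | ∀ i, |x i| ≤ X} := by
  have hint : Integrable (fun y : ℝ => |y| ^ s) (gaussianReal 0 1) := by
    have := (memLp_id_gaussianReal' (μ := 0) (v := 1) (ENNReal.ofReal s)
      ENNReal.ofReal_ne_top).integrable_norm_rpow (by simpa using hs) ENNReal.ofReal_ne_top
    simpa [ENNReal.toReal_ofReal hs.le] using this
  have h0 : 0 ≤ ∫ y, |y| ^ s ∂gaussianReal 0 1 := integral_nonneg fun y => by positivity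
  refine ⟨(∫ y, |y| ^ s ∂gaussianReal 0 1) + 1, by linarith, fun ι _ X hX => ?_⟩
  set C := (∫ y, |y| ^ s ∂gaussianReal 0 1) + 1
  -- Markov for the absolute moment of order `s`; a union bound over the coordinates follows.
  have h1 : (gaussianReal 0 1).real {y | X < |y|} ≤ C / X ^ s := by
    have h2 := mul_meas_ge_le_integral_of_nonneg (μ := gaussianReal 0 1)
      (Filter.Eventually.of_forall fun y => Real.rpow_nonneg (abs_nonneg y) s) hint (X ^ s)
    rw [le_div_iff₀' (by positivity)]
    refine le_trans (mul_le_mul_of_nonneg_left (measureReal_mono fun y hy => ?_)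
      (by positivity)) (h2.trans (by simp only [C]; linarith))
    exact Real.rpow_le_rpow hX.le (le_of_lt hy) hs.le
  have hm : MeasurableSet {x : ι → ℝ | ∀ i, |x i| ≤ X} := by
    rw [Set.ofPred_forall]
    exact MeasurableSet.iInter fun i => measurableSet_le (by fun_prop) measurable_const
  have h5 := probReal_compl_eq_one_sub (μ := gaussianPi ι) hm
  have h6 : (gaussianPi ι).real {x : ι → ℝ | ∀ i, |x i| ≤ X}ᶜ ≤ Fintype.card ι * C / X ^ s := by
    have hsub : {x : ι → ℝ | ∀ i, |x i| ≤ X}ᶜ ⊆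
        ⋃ i ∈ (Finset.univ : Finset ι), Function.eval i ⁻¹' {y : ℝ | X < |y|} := by
      intro x hx
      simp only [Set.mem_compl_iff, Set.mem_ofPred_eq, not_forall, not_le] at hx
      obtain ⟨i, hi⟩ := hx
      simp only [Set.mem_iUnion]
      exact ⟨i, Finset.mem_univ i, hi⟩
    refine (measureReal_mono hsub (measure_ne_top _ _)).trans ((measureReal_biUnion_finset_le _ _).trans ?_)
    calc ∑ i : ι, (gaussianPi ι).real (Function.eval i ⁻¹' {y : ℝ | X < |y|})
        ≤ ∑ _i : ι, C / X ^ s := by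
          refine Finset.sum_le_sum fun i _ => le_trans (le_of_eq ?_) h1
          exact (measurePreserving_eval_gaussianPi i).measureReal_preimage
            (measurableSet_lt measurable_const measurable_id.abs).nullMeasurableSet
      _ = _ := by simp; ring
  linarith

theorem sum_add_smul_sq_le {x v : ι → ℝ} {a t c C : ℝ} (ha : 0 ≤ a) (ht : 0 ≤ t)
    (hc : 0 ≤ c) (hcC : c ≤ C) (hx : ∑ i, x i ^ 2 ≤ a ^ 2) (hv : ∑ i, v i ^ 2 ≤ t ^ 2) :
    ∑ i, (x + c • v) i ^ 2 ≤ (a + C * t) ^ 2 := by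
  have h1 : ∑ i, x i * v i ≤ a * t := by
    refine abs_le_of_sq_le_sq' ?_ (by positivity) |>.2
    rw [mul_pow]
    exact (Finset.sum_mul_sq_le_sq_mul_sq _ _ _).trans
      (mul_le_mul hx hv (Finset.sum_nonneg fun _ _ => sq_nonneg _) (sq_nonneg _))
  have h2 : ∑ i, (x + c • v) i ^ 2 =
      ∑ i, x i ^ 2 + 2 * c * ∑ i, x i * v i + c ^ 2 * ∑ i, v i ^ 2 := by
    rw [Finset.mul_sum, Finset.mul_sum, ← Finset.sum_add_distrib, ← Finset.sum_add_distrib]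
    exact Finset.sum_congr rfl fun i _ => by simp; ring
  have h3 : ∑ i, (x + c • v) i ^ 2 ≤ (a + c * t) ^ 2 := by
    rw [h2]
    nlinarith [mul_le_mul_of_nonneg_left h1 hc, mul_le_mul_of_nonneg_left hv (sq_nonneg c)]
  exact h3.trans (by gcongr)

end GaussianTails

/-- The failure probability that a shift of a Gaussian matrix by `t` forces. -/
noncomputable def shiftFailure (M : ℕ) (t : ℝ) : ℝ :=
  (1 - 1 / (M : ℝ)) * (1 - 1 / (M : ℝ) ^ 2 - 1 / (M : ℝ) ^ 2) *
    Real.exp (-(M * M * t + (M : ℝ) ^ 2 * t ^ 2 / 2))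

/-! ### The shift argument for `p ≤ 2` and for `p > 2`. -/

namespace NonAdaptiveAlgorithm

variable {Ω : Type*} [MeasurableSpace Ω] {n r k : ℕ} {alg : NonAdaptiveAlgorithm Ω n r k}
  {μ : Measure Ω} [IsProbabilityMeasure μ] {p ε δ : ℝ}

/-- If `m ≥ 2 * r`, one Gaussian `m × m` block has an invisible direction of trace at least `t * √(m
/ 2)`, while the Frobenius bound makes the allowed error of order `ε * m ^ (1 / p) * √m`. -/
theorem EstimatesTrace.lt_two_mul_of_le_two (hest : alg.EstimatesTrace μ p ε δ) (hp : 0 < p)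
    (hp2 : p ≤ 2) (hε : 0 < ε) {M m : ℕ} {t : ℝ} (hM : 1 ≤ M) (ht : 0 < t)
    (hδ : δ < shiftFailure M t) (hm : 0 < m) (hmn : m ≤ n) (hMt : M * t ≤ m)
    (hmt : 3 * (M + 1) * ε * (m : ℝ) ^ (1 / p) < t) : m < 2 * r := by
  by_contra! hr
  have hm0 : (0 : ℝ) < m := by exact_mod_cast hm
  have hM0 : (0 : ℝ) < M := by exact_mod_cast hM
  obtain ⟨e⟩ : Nonempty (Fin m × Fin 1 ↪ Fin n) :=
    Function.Embedding.nonempty_of_card_le (by simpa using hmn)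
  -- The mean squared norm is `m ^ 2`, so the norm exceeds `M * m` with probability at most `1 / M ^
  -- 2`.
  set a : ℝ := M * m
  have ha : 0 < a := by positivity
  set h : ℝ := ε * ((m : ℝ) ^ (1 / p - 1 / 2) * (a + M * t))
  have hmul : (m : ℝ) ^ (1 / p - 1 / 2) * m = (m : ℝ) ^ (1 / p) * √m := by
    rw [Real.rpow_sub hm0, ← Real.sqrt_eq_rpow, div_mul_eq_mul_div, div_eq_iff (by positivity),
      mul_assoc, Real.mul_self_sqrt hm0.le]
  have hh : 2 * h < t * √(1 * ((m : ℝ) - r)) := by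
    have h1 : h ≤ ε * ((M + 1) * ((m : ℝ) ^ (1 / p) * √m)) := by
      rw [← hmul]
      have : a + M * t ≤ (M + 1) * m := by simp only [a]; linarith
      calc h ≤ ε * ((m : ℝ) ^ (1 / p - 1 / 2) * ((M + 1) * m)) := by
            simp only [h]; gcongr
        _ = _ := by ring
    -- From `m - r ≥ m / 2 ≥ (4 / 9) m`; this produces the factor `3` in `hmt`.
    have h2 : √m * (2 / 3) ≤ √(1 * ((m : ℝ) - r)) := by
      apply Real.le_sqrt_of_sq_le
      rw [mul_pow, Real.sq_sqrt hm0.le]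
      have : (2 : ℝ) * r ≤ m := by exact_mod_cast hr
      linarith
    calc 2 * h ≤ (3 * (M + 1) * ε * (m : ℝ) ^ (1 / p)) * (√m * (2 / 3)) := by linarith
      _ < t * (√m * (2 / 3)) := by
          have : 0 < √(m : ℝ) := Real.sqrt_pos.2 hm0
          gcongr
      _ ≤ _ := by gcongr
  refine absurd hδ (not_lt.2 ?_)
  refine hest.gaussian_shift_le (blockEmbedding e)
    (Y := {x | ∑ i, x i ^ 2 ≤ (a + M * t) ^ 2}) (Z := {x | ∑ i, x i ^ 2 ≤ a ^ 2}) (h := h)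
    (measurableSet_le (by fun_prop) measurable_const)
    (measurableSet_le (by fun_prop) measurable_const) ht hM0 hM ?_ ?_ ?_ ?_
  · refine le_trans (le_of_eq ?_) (one_sub_le_gaussianPi_sum_sq_le ha)
    simp only [Fintype.card_prod, Fintype.card_fin, a]
    push_cast
    field_simp
  · intro x hx
    refine mul_le_mul_of_nonneg_left (schattenNorm_le_frobenius hp hp2 _
      ((rank_blockEmbedding_le e x).trans_eq (mul_one m)) (by positivity) ?_) hε.le
    rw [sum_sq_blockEmbedding]
    exact hx
  · intro Q
    obtain ⟨v, hv, hv0, hvt⟩ := exists_invisible_direction e ht (by omega : r < m) one_pos Q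
    refine ⟨v, hv, hv0, hh.trans_le ?_⟩
    simpa using hvt
  · intro x hx v hv j hj
    exact sum_add_smul_sq_le ha.le ht.le (Nat.cast_nonneg j) (by exact_mod_cast hj.le) hx hv

/-- Blocks of size `R + 1` leave each at least one invisible dimension when `r ≤ R`, so the trace
shift is at least `t * √N`. The allowed error is of order `N ^ (1 / p)` times the largest entry,
which is negligible against `√N` because `p > 2`. -/
theorem exists_card_not_estimatesTrace (hp : 2 < p) (hε : 0 < ε) {M : ℕ} {t : ℝ}
    (hM : 1 ≤ M) (ht : 0 < t) (hδ : δ < shiftFailure M t) (R : ℕ) :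
    ∃ n₀ : ℕ, ∀ n, n₀ ≤ n → ∀ (r k : ℕ) (Ω : Type*) [MeasurableSpace Ω] (μ : Measure Ω)
      [IsProbabilityMeasure μ] (alg : NonAdaptiveAlgorithm Ω n r k),
      alg.EstimatesTrace μ p ε δ → R < r := by
  have hM0 : (0 : ℝ) < M := by exact_mod_cast hM
  set θ : ℝ := 1 / 2 - 1 / p with hθ
  have hθ0 : 0 < θ := by
    have : 1 / p < 1 / 2 := one_div_lt_one_div_of_lt two_pos hp
    linarith
  -- Chosen so that `X = c * N ^ (θ / 2)` has `X ^ s` linear in `N`; the constant `c` then makes the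
  -- tail bound exactly `1 / M ^ 2`.
  set s : ℝ := 2 / θ
  have hs : 0 < s := by positivity
  obtain ⟨C, hC, htail⟩ := exists_one_sub_le_gaussianPi_abs_le s hs
  set b : ℕ := R + 1
  have hb : (0 : ℝ) < b := by positivity
  set c : ℝ := (b * b * C * M ^ 2) ^ (θ / 2)
  have hc : 0 < c := by positivity
  set A : ℝ := 2 * ε * ((b : ℝ) ^ (1 / p) * b)
  have hA : 0 < A := by positivity
  obtain ⟨N, hN1, hN2⟩ : ∃ N : ℕ, 1 ≤ N ∧ max 1 (A * (c + M * t) / t) < (N : ℝ) ^ (θ / 2) := by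
    have h1 := ((tendsto_rpow_atTop (by positivity : 0 < θ / 2)).comp
      tendsto_natCast_atTop_atTop).eventually_gt_atTop (max 1 (A * (c + M * t) / t))
    obtain ⟨N, hN⟩ := (h1.and (Filter.eventually_ge_atTop 1)).exists
    exact ⟨N, hN.2, hN.1⟩
  have hN0 : (0 : ℝ) < N := by exact_mod_cast hN1
  set u : ℝ := (N : ℝ) ^ (θ / 2) with hu
  have hu1 : 1 < u := (le_max_left _ _).trans_lt hN2
  have hu2 : A * (c + M * t) < u * t := by
    rw [← div_lt_iff₀ ht]; exact (le_max_right _ _).trans_lt hN2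
  set X : ℝ := c * u
  have hX : 0 < X := by positivity
  refine ⟨b * N, fun n hn r k Ω _ μ _ alg hest => ?_⟩
  by_contra! hrR
  obtain ⟨e⟩ : Nonempty (Fin b × Fin N ↪ Fin n) :=
    Function.Embedding.nonempty_of_card_le (by simpa using hn)
  set h : ℝ := ε * (((b * N : ℕ) : ℝ) ^ (1 / p) * (b * (X + M * t)))
  have hh : 2 * h < t * √N := by
    have h1 : 2 * h = A * (N : ℝ) ^ (1 / p) * (X + M * t) := by
      simp only [h, A]
      push_cast
      rw [Real.mul_rpow hb.le hN0.le]
      ring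
    -- The exponent `1 / 2 = 1 / p + θ` leaves two factors `u`: one absorbs the growth of `X`, the
    -- other beats the constants.
    have h2 : √(N : ℝ) = (N : ℝ) ^ (1 / p) * (u * u) := by
      rw [hu, ← Real.rpow_add hN0, ← Real.rpow_add hN0, Real.sqrt_eq_rpow]
      congr 1
      rw [hθ]; ring
    have h3 : A * (X + M * t) < t * (u * u) := by
      calc A * (X + M * t) ≤ A * (c + M * t) * u := by
            have : M * t * 1 ≤ M * t * u := by gcongr
            simp only [X]
            nlinarith
        _ < u * t * u := by gcongr
        _ = _ := by ring
    rw [h1, h2]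
    have : 0 < (N : ℝ) ^ (1 / p) := by positivity
    nlinarith
  refine absurd hδ (not_lt.2 ?_)
  refine hest.gaussian_shift_le (blockEmbedding e)
    (Y := {x | ∀ i, |x i| ≤ X + M * t}) (Z := {x | ∀ i, |x i| ≤ X}) (h := h)
    ?_ ?_ ht hM0 hM ?_ ?_ ?_ ?_
  · rw [Set.ofPred_forall]
    exact MeasurableSet.iInter fun i => measurableSet_le (by fun_prop) measurable_const
  · rw [Set.ofPred_forall]
    exact MeasurableSet.iInter fun i => measurableSet_le (by fun_prop) measurable_const
  · refine le_trans (le_of_eq ?_) (htail _ X hX)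
    have hXs : X ^ s = b * b * C * M ^ 2 * N := by
      have hs1 : θ / 2 * s = 1 := by simp only [s]; field_simp
      rw [Real.mul_rpow hc.le (by positivity), ← Real.rpow_mul (by positivity),
        ← Real.rpow_mul hN0.le, hs1, Real.rpow_one, Real.rpow_one]
    rw [hXs]
    simp only [Fintype.card_prod, Fintype.card_fin]
    push_cast
    field_simp
  · intro x hx
    refine mul_le_mul_of_nonneg_left (schattenNorm_le_of_rank_le (by linarith) _
      (rank_blockEmbedding_le e x) (by positivity) ?_) hε.le
    exact sum_sq_blockEmbedding_mulVec_le e x hx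
  · intro Q
    obtain ⟨v, hv, hv0, hvt⟩ := exists_invisible_direction e ht (by omega : r < b) hN1 Q
    refine ⟨v, hv, hv0, hh.trans_le (le_trans ?_ hvt)⟩
    have : (r : ℝ) + 1 ≤ b := by exact_mod_cast (by omega : r + 1 ≤ b)
    have h1 : (N : ℝ) * 1 ≤ N * ((b : ℝ) - r) := by gcongr; linarith
    rw [mul_one] at h1
    gcongr
  · intro x hx v hv j hj i
    have h1 : |v i| ≤ t := by
      refine abs_le_of_sq_le_sq ?_ ht.le
      exact (Finset.single_le_sum (f := fun i => v i ^ 2) (fun _ _ => sq_nonneg _)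
        (Finset.mem_univ i)).trans hv
    have h2 : (j : ℝ) ≤ M := by exact_mod_cast hj.le
    calc |(x + (j : ℝ) • v) i| ≤ |x i| + |(j : ℝ) * v i| := abs_add_le _ _
      _ = |x i| + j * |v i| := by rw [abs_mul, Nat.abs_cast]
      _ ≤ X + M * t := add_le_add (hx i) (by gcongr)

end NonAdaptiveAlgorithm

/-! ### Choice of constants, and the bit count. -/

theorem exists_nat_lt_one_sub_mul {x : ℝ} (hx : x < 1) :
    ∃ M : ℕ, 1 ≤ M ∧ x < (1 - 1 / (M : ℝ)) * (1 - 1 / (M : ℝ) ^ 2 - 1 / (M : ℝ) ^ 2) := by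
  have h0 : Filter.Tendsto (fun M : ℕ => 1 / (M : ℝ)) Filter.atTop (nhds 0) :=
    tendsto_one_div_atTop_nhds_zero_nat
  have h2 : Filter.Tendsto (fun M : ℕ => (1 / (M : ℝ)) ^ 2) Filter.atTop (nhds 0) := by
    simpa using h0.pow 2
  have h := (h0.const_sub 1).mul ((h2.const_sub 1).sub h2)
  simp only [sub_zero, mul_one] at h
  obtain ⟨M, hM⟩ := ((h.eventually_const_lt hx).and (Filter.eventually_ge_atTop 1)).exists
  exact ⟨M, hM.2, by simpa [one_div_pow] using hM.1⟩

/-- Constants for which the shift argument contradicts every failure probability `δ ≤ δ₀`. -/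
theorem exists_lt_shiftFailure {δ₀ : ℝ} (h0 : 0 < δ₀) (h1 : δ₀ < 1) :
    ∃ (M : ℕ) (σ : ℝ), 1 ≤ M ∧ δ₀ < 1 - 1 / (M : ℝ) ∧ 0 < σ ∧ σ ≤ 1 ∧
      ∀ δ, 0 < δ → δ ≤ δ₀ → δ < shiftFailure M (σ * √(Real.log (1 / δ))) := by
  set L₀ := Real.log (1 / δ₀)
  have hL₀ : 0 < L₀ := Real.log_pos (by rw [lt_div_iff₀ h0]; linarith)
  -- The exponent of `shiftFailure` will cost at most `2 * L / 3`. A prefactor above `exp (-(L₀ /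
  -- 3))` then suffices, since `L₀ ≤ L`.
  obtain ⟨M, hM, hMx⟩ := exists_nat_lt_one_sub_mul
    (x := max (Real.exp (-(L₀ / 3))) δ₀) (max_lt (by rw [Real.exp_lt_one_iff]; linarith) h1)
  set q := (1 - 1 / (M : ℝ)) * (1 - 1 / (M : ℝ) ^ 2 - 1 / (M : ℝ) ^ 2) with hq
  have hM1 : (1 : ℝ) ≤ M := by exact_mod_cast hM
  have hM0 : (0 : ℝ) < M := by linarith
  have hMδ : δ₀ < 1 - 1 / (M : ℝ) := by
    refine ((le_max_right _ _).trans_lt hMx).trans_le ?_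
    have h2 : 0 ≤ 1 - 1 / (M : ℝ) := by
      rw [sub_nonneg, div_le_one hM0]; exact hM1
    have h3 : 0 ≤ 1 / (M : ℝ) ^ 2 := by positivity
    rw [hq]
    nlinarith
  -- The two terms make the linear and the quadratic part of the exponent at most `L / 3` each.
  set σ : ℝ := min (√L₀ / (3 * M ^ 2)) (1 / (3 * M))
  have hσ : 0 < σ := lt_min (by positivity) (by positivity)
  have hσ1 : M ^ 2 * σ ≤ √L₀ / 3 := by
    calc M ^ 2 * σ ≤ M ^ 2 * (√L₀ / (3 * M ^ 2)) := by gcongr; exact min_le_left _ _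
      _ = _ := by field_simp
  have hσ2 : M * σ ≤ 1 / 3 := by
    calc M * σ ≤ M * (1 / (3 * M)) := by gcongr; exact min_le_right _ _
      _ = _ := by field_simp
  refine ⟨M, σ, hM, hMδ, hσ, by nlinarith, fun δ hδ hδ₀ => ?_⟩
  set L := Real.log (1 / δ) with hL
  have hLL : L₀ ≤ L := Real.log_le_log (by positivity) (one_div_le_one_div_of_le hδ hδ₀)
  have hLs : √L ^ 2 = L := Real.sq_sqrt (by linarith)
  have hexp : Real.exp (-L) = δ := by
    rw [hL, one_div, Real.log_inv, neg_neg, Real.exp_log hδ]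
  have hb1 : M * M * (σ * √L) ≤ L / 3 := by
    have h4 : √L₀ ≤ √L := Real.sqrt_le_sqrt hLL
    have h5 : 0 ≤ √L := Real.sqrt_nonneg _
    calc M * M * (σ * √L) = M ^ 2 * σ * √L := by ring
      _ ≤ √L₀ / 3 * √L := by gcongr
      _ ≤ √L / 3 * √L := by gcongr
      _ = √L ^ 2 / 3 := by ring
      _ = L / 3 := by rw [hLs]
  have hb2 : (M : ℝ) ^ 2 * (σ * √L) ^ 2 / 2 ≤ L / 3 := by
    have h6 : (M * σ) ^ 2 ≤ (1 / 3) ^ 2 := by gcongr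
    have h7 : (M : ℝ) ^ 2 * (σ * √L) ^ 2 = (M * σ) ^ 2 * L := by
      rw [mul_pow σ, hLs]; ring
    rw [h7]
    nlinarith
  calc δ = Real.exp (-L) := hexp.symm
    _ ≤ Real.exp (-(L₀ / 3)) * Real.exp (-(2 * L / 3)) := by
        rw [← Real.exp_add]; exact Real.exp_le_exp.2 (by linarith)
    _ < q * Real.exp (-(2 * L / 3)) := by
        have := (le_max_left _ _).trans_lt hMx
        gcongr
    _ ≤ shiftFailure M (σ * √L) := by
        have hq0 : 0 ≤ q := (Real.exp_pos _).le.trans ((le_max_left _ _).trans_lt hMx).le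
        rw [shiftFailure, ← hq]
        gcongr
        linarith

namespace NonAdaptiveAlgorithm

/-- The queries must carry a number of bits proportional to `log (1 / δ)`. -/
theorem exists_card_log_le_bits {δ₀ δ : ℝ} {M : ℕ} (hM : 1 ≤ M) (hMδ : δ₀ < 1 - 1 / (M : ℝ))
    (hδ : 0 < δ) (hδ₀ : δ ≤ δ₀) :
    ∃ n₀ : ℕ, ∀ n, n₀ ≤ n → ∀ (p ε : ℝ) (r k : ℕ) (Ω : Type*) [MeasurableSpace Ω] (μ : Measure Ω)
      [IsProbabilityMeasure μ] (alg : NonAdaptiveAlgorithm Ω n r k), 0 < p → 0 < ε → ε < 1 →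
      alg.EstimatesTrace μ p ε δ → 1 ≤ k * r ∧ Real.log (1 / δ) ≤ 4 * (k * r : ℕ) := by
  have hinv : Filter.Tendsto (fun n : ℕ => 1 / (n : ℝ)) Filter.atTop (nhds 0) :=
    tendsto_one_div_atTop_nhds_zero_nat
  have h1 : Filter.Tendsto (fun n : ℕ => (1 - 1 / (M : ℝ)) * (1 - 1 / (n : ℝ))) Filter.atTop
      (nhds (1 - 1 / (M : ℝ))) := by
    simpa using (hinv.const_sub 1).const_mul (1 - 1 / (M : ℝ))
  obtain ⟨n₀, hn₀⟩ := Filter.eventually_atTop.1 (((h1.eventually_const_lt hMδ).and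
    (hinv.eventually_lt_const (by positivity : 0 < 4 * δ))).and (Filter.eventually_gt_atTop 0))
  refine ⟨n₀, fun n hn p ε r k Ω _ μ _ alg hp hε0 hε1 hest => ?_⟩
  obtain ⟨⟨ha, hb⟩, hc⟩ := hn₀ n hn
  -- Without query bits every pair collides, and `J = M` forces a failure probability above `δ₀`.
  -- With `k * r ≥ 1` the additive constant in the bit bound can be absorbed.
  have hkr : 1 ≤ k * r := by
    by_contra! hlt
    have h0 : k * r = 0 := by omega
    have := hest.pair_le hp hε0 hε1 hc hM
    rw [h0, pow_zero, div_one] at this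
    linarith
  refine ⟨hkr, ?_⟩
  have h2 := hest.pair_le hp hε0 hε1 hc (J := 2) (by norm_num)
  have h3 : 1 / (2 : ℝ) ^ (k * r) ≤ 8 * δ := by
    push_cast at h2
    linarith
  have h4 : Real.log (1 / (2 : ℝ) ^ (k * r)) ≤ Real.log (8 * δ) :=
    Real.log_le_log (by positivity) h3
  have h8 : Real.log 8 = 3 * Real.log 2 := by
    rw [show (8 : ℝ) = 2 ^ 3 by norm_num, Real.log_pow]; norm_num
  rw [one_div, Real.log_inv, Real.log_pow, Real.log_mul (by norm_num) hδ.ne', h8] at h4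
  rw [one_div, Real.log_inv]
  have h5 : Real.log 2 ≤ 1 := by linarith [Real.log_two_lt_d9]
  have h6 : 0 < Real.log 2 := Real.log_pos one_lt_two
  have h7 : (1 : ℝ) ≤ (k * r : ℕ) := by exact_mod_cast hkr
  nlinarith

end NonAdaptiveAlgorithm

/-! ### Assembly of the lower bound. -/

theorem mainTheorem4 :
    ∀ δ₀ : ℝ, 0 < δ₀ → δ₀ < 1 →
      ∃ c : ℝ, 0 < c ∧
        ∀ (p ε δ : ℝ) (k : ℕ), 0 < p → 0 < ε → ε < 1 → 0 < δ → δ ≤ δ₀ →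
          ∃ n₀ : ℕ, ∀ n : ℕ, n₀ ≤ n →
            ∀ (r : ℕ) (Ω : Type*) [MeasurableSpace Ω] (μ : Measure Ω) [IsProbabilityMeasure μ]
              (alg : NonAdaptiveAlgorithm Ω n r k),
              alg.EstimatesTrace μ p ε δ →
                c * (Real.log (1 / δ) ^ (p / 2) / (ε ^ p * ((k : ℝ) + Real.log (1 / ε)))) ≤ (r : ℝ) := by
  intro δ₀ h0 h1
  obtain ⟨M, σ, hM, hMδ, hσ, hσ1, hfail⟩ := exists_lt_shiftFailure h0 h1
  set L₀ := Real.log (1 / δ₀)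
  have hL₀ : 0 < L₀ := Real.log_pos (by rw [lt_div_iff₀ h0]; linarith)
  have hM0 : (0 : ℝ) < M := by exact_mod_cast hM
  set a : ℝ := σ / (3 * (M + 1)) with ha
  have ha0 : 0 < a := by positivity
  have ha1 : a < 1 := by
    rw [ha, div_lt_one (by positivity)]; linarith
  -- With this value, `B > C * L` yields `M * (σ * √L) ≤ a ^ 2 * B / 4 ≤ m`, as the shift argument
  -- requires.
  set C : ℝ := 4 * M * σ / (a ^ 2 * √L₀) with hC
  have hC0 : 0 < C := by positivity
  refine ⟨min (1 / (4 * C)) (a ^ 2 / 8), by positivity, ?_⟩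
  set c := min (1 / (4 * C)) (a ^ 2 / 8)
  have hc0 : 0 < c := by positivity
  have hcC : c * (4 * C) ≤ 1 := by
    rw [← le_div_iff₀ (by positivity)]; exact min_le_left _ _
  have hca : c ≤ a ^ 2 / 8 := min_le_right _ _
  intro p ε δ k hp hε0 hε1 hδ hδ₀
  set L := Real.log (1 / δ)
  have hLL : L₀ ≤ L := Real.log_le_log (by positivity) (one_div_le_one_div_of_le hδ hδ₀)
  have hL : 0 < L := hL₀.trans_le hLL
  have hlogε : 0 < Real.log (1 / ε) := Real.log_pos (by rw [lt_div_iff₀ hε0]; linarith)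
  have hδfail := hfail δ hδ hδ₀
  have ht : 0 < σ * √L := by positivity
  set D : ℝ := (k : ℝ) + Real.log (1 / ε)
  have hD0 : 0 < D := by positivity
  set B : ℝ := L ^ (p / 2) / ε ^ p with hB
  have hB0 : 0 < B := by positivity
  have hgoal : c * (L ^ (p / 2) / (ε ^ p * D)) = c * B / D := by
    rw [hB]; field_simp
  rw [hgoal]
  rcases lt_or_ge 2 p with hp2 | hp2
  · obtain ⟨n₀, hn₀⟩ := NonAdaptiveAlgorithm.exists_card_not_estimatesTrace hp2 hε0 hM ht hδfail
      ⌈c * B / D⌉₊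
    refine ⟨n₀, fun n hn r Ω _ μ _ alg hest => ?_⟩
    exact (Nat.le_ceil _).trans (by exact_mod_cast (hn₀ n hn r k Ω μ alg hest).le)
  · obtain ⟨n₁, hn₁⟩ := NonAdaptiveAlgorithm.exists_card_log_le_bits hM hMδ hδ hδ₀
    set m : ℕ := ⌊a ^ 2 * B / 2⌋₊
    refine ⟨max n₁ m, fun n hn r Ω _ μ _ alg hest => ?_⟩
    obtain ⟨hkr, hLkr⟩ := hn₁ n ((le_max_left _ _).trans hn) p ε r k Ω μ alg hp hε0 hε1 hest
    have hk : (1 : ℝ) ≤ k := by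
      exact_mod_cast Nat.pos_of_ne_zero fun h => by simp [h] at hkr
    have hr : (1 : ℝ) ≤ r := by
      exact_mod_cast Nat.pos_of_ne_zero fun h => by simp [h] at hkr
    have hkD : (k : ℝ) ≤ D := by simp only [D]; linarith
    rw [div_le_iff₀ hD0]
    -- For `B ≤ C * L` the bit count `L ≤ 4 * (k * r)` suffices. Otherwise the shift argument gives
    -- `c * B ≤ r`, which is enough because `D ≥ k ≥ 1`.
    rcases le_or_gt B (C * L) with hBL | hBL
    · push_cast at hLkr
      calc c * B ≤ c * (C * L) := by gcongr
        _ ≤ c * (C * (4 * (k * r))) := by gcongr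
        _ = c * (4 * C) * (k * r) := by ring
        _ ≤ 1 * (k * r) := by gcongr
        _ = r * k := by ring
        _ ≤ r * D := by gcongr
    have hcB : c * B ≤ a ^ 2 * B / 8 := by
      linarith [mul_le_mul_of_nonneg_right hca hB0.le]
    have hfin : c * B ≤ r → c * B ≤ r * D := fun h =>
      h.trans (le_mul_of_one_le_right (by linarith) (hk.trans hkD))
    -- Below `4` the target `c * B` is less than `1 ≤ r`; from `4` on, rounding down in `m` loses at
    -- most half.
    rcases lt_or_ge (a ^ 2 * B) 4 with hB4 | hB4
    · exact hfin (by linarith)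
    have hm1 : a ^ 2 * B / 4 ≤ m := by
      have := Nat.lt_floor_add_one (a ^ 2 * B / 2)
      linarith
    have hm2 : (m : ℝ) < a ^ 2 * B := by
      have := Nat.floor_le (by positivity : 0 ≤ a ^ 2 * B / 2)
      linarith
    have hm0 : (0 : ℝ) < m := by linarith
    have hMt : M * (σ * √L) ≤ m := by
      refine le_trans ?_ hm1
      have h2 : a ^ 2 * (C * L) = 4 * M * σ * (L / √L₀) := by
        rw [hC]; field_simp
      have h3 : √L ≤ L / √L₀ := by
        rw [le_div_iff₀ (by positivity)]
        calc √L * √L₀ ≤ √L * √L := by gcongr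
          _ = L := Real.mul_self_sqrt hL.le
      have h4 : a ^ 2 * (C * L) ≤ a ^ 2 * B := by gcongr
      rw [h2] at h4
      have h5 : 4 * M * σ * √L ≤ 4 * M * σ * (L / √L₀) := by gcongr
      linarith
    have hmt : 3 * (M + 1) * ε * (m : ℝ) ^ (1 / p) < σ * √L := by
      -- Since `a < 1` and `p ≤ 2`, `a ^ 2 ≤ a ^ p`; using `a ^ 2` keeps `c` independent of `p`.
      have h2 : a ^ 2 * B ≤ (a * √L / ε) ^ p := by
        rw [Real.div_rpow (by positivity) hε0.le, Real.mul_rpow ha0.le (by positivity),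
          Real.sqrt_eq_rpow, ← Real.rpow_mul hL.le, one_div_mul_eq_div, mul_div_assoc, ← hB,
          ← Real.rpow_two]
        exact mul_le_mul_of_nonneg_right
          (Real.rpow_le_rpow_of_exponent_ge ha0 ha1.le hp2) hB0.le
      have h3 : (m : ℝ) ^ (1 / p) < a * √L / ε := by
        have := Real.rpow_lt_rpow hm0.le (hm2.trans_le h2) (by positivity : 0 < 1 / p)
        rwa [← Real.rpow_mul (by positivity), mul_one_div_cancel hp.ne', Real.rpow_one] at this
      calc 3 * (M + 1) * ε * (m : ℝ) ^ (1 / p) < 3 * (M + 1) * ε * (a * √L / ε) := by gcongr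
        _ = σ * √L := by rw [ha]; field_simp
    have hmr := hest.lt_two_mul_of_le_two hp hp2 hε0 hM ht hδfail (by exact_mod_cast hm0)
      ((le_max_right _ _).trans hn) hMt hmt
    have hmr' : (m : ℝ) ≤ 2 * r := by exact_mod_cast hmr.le
    exact hfin (by linarith)
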